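/- Let $p\ge 1$ be an integer. There are constants $C_1,C_2>0$ depending only on $p$ such that the following holds. Setting. Let $\mathcal Z\subset\mathbb R^d$ be nonempty, compact and convex with diameter $D=\sup_{z,z'\in\mathcal Z}\|z-z'\|$ (Euclidean norm), and let $\mathcal N_{\mathcal Z}(z)=\{u:\langle u,w-z\rangle\le 0\ \forall w\in\mathcal Z\}$. Let $h:\mathcal Z\to\mathbb R$ be differentiable on $\mathcal Z$ with gradient $\nabla h$ and, for some $\mu>0$, $(p+1)$-th-order $\mu$-uniformly convex: $$h(z)\ge h(z')+\langle\nabla h(z'),z-z'\rangle+\tfrac{\mu}{p+1}\|z-z'\|^{p+1}\qquad\forall z,z'\in\mathcal Z .$$ Let $\gamma>0$, $\epsilon>0$, $\delta\ge 0$, and let the following oracles be given on $\mathcal Z$: $\mathrm{iFunc}(z)\in\mathbb R$ with $|\mathrm{iFunc}(z)-h(z)|\le\delta$; $\mathrm{iGrad}(z)\in\mathbb R^d$ with $\|\mathrm{iGrad}(z)-\nabla h(z)\|\le\delta$; and $\mathrm{iProx}(\bar z)=(z,u)$ with $z\in\mathcal Z$, $u\in\mathcal N_{\mathcal Z}(z)$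 and $$\|\nabla h(z)+u+\lambda(z-\bar z)\|\le\tfrac{\lambda}{2}\|z-\bar z\|+\delta,\qquad \lambda=\gamma\|z-\bar z\|^{p-1}$$ (with $0^0=1$). Algorithm (AIPE-restart with $S$ epochs of length $T$, started at $z^{(0)}\in\mathcal Z$). Epoch $s=0,\dots,S-1$ starts with $z_0=v_0=z^{(s)}$, $A_0=0$ and $\lambda_1'=\lambda_1$, where $\lambda_1=\gamma\|\tilde z_1-z^{(s)}\|^{p-1}$ and $\tilde z_1$ is the point returned by $\mathrm{iProx}(z^{(s)})$. If $\lambda_1=0$ (so that $\tilde z_1=z^{(s)}$), the epoch ends with $z^{(s+1)}=z^{(s)}$. Otherwise, for $t=0,\dots,T-1$: let $a_{t+1}'>0$ solve $A_t+a_{t+1}'=2\lambda_{t+1}'(a_{t+1}')^2$, and put $$A_{t+1}'=A_t+a_{t+1}',\quad \bar z_t=\tfrac{A_t}{A_{t+1}'}z_t+\tfrac{a_{t+1}'}{A_{t+1}'}v_t,\quad (\tilde z_{t+1},u_{t+1})=\mathrm{iProx}(\bar z_t),\quad \lambda_{t+1}=\gamma\|\tilde z_{t+1}-\bar z_t\|^{p-1};$$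 if $\lambda_{t+1}\le\lambda_{t+1}'$, put $\gamma_{t+1}=1$ and $\lambda_{t+2}'=\lambda_{t+1}'/2$; otherwise put $\gamma_{t+1}=\lambda_{t+1}'/\lambda_{t+1}$ and $\lambda_{t+2}'=2\lambda_{t+1}'$; then $$a_{t+1}=\gamma_{t+1}a_{t+1}',\quad A_{t+1}=A_t+a_{t+1},\quad z_{t+1}=\tfrac{(1-\gamma_{t+1})A_t}{A_{t+1}}z_t+\tfrac{\gamma_{t+1}A_{t+1}'}{A_{t+1}}\tilde z_{t+1},$$ $$v_{t+1}=\mathrm{Proj}_{\mathcal Z}\big(v_t-a_{t+1}(\mathrm{iGrad}(\tilde z_{t+1})+u_{t+1})\big).$$ The epoch's output $z^{(s+1)}$ is a point with the lowest value of $\mathrm{iFunc}$ among $z_0,\dots,z_T,\tilde z_1,\dots,\tilde z_T$ (ties broken arbitrarily). The algorithm returns $z^{(S)}$. Claim. Let $z^*\in\arg\min_{\mathcal Z}h$ and $\Delta=h(z^{(0)})-h(z^*)$, and suppose (if $\Delta>0$) that $$\delta\le\min\left\{\frac{(1+\sqrt{17})\,\epsilon^2\min\left\{D,\left(\frac{(p+1)\epsilon^2}{2\mu\Delta}\right)^{\frac1{p+1}}\right\}}{2^7(7+\sqrt6)D^2\Delta},\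 \frac{\epsilon^2}{2^4\max\{D,1\}\Delta}\right\}.$$ Run the algorithm with $T=\lceil C_1(\gamma/\mu)^{2/(3p+1)}\rceil$ and $S=\lceil\log_2(\Delta/\epsilon)\rceil$ (read as $0$ if $\Delta\le\epsilon$). Then every run returns a point $z^{(S)}\in\mathcal Z$ with $h(z^{(S)})-h(z^*)\le\epsilon$. Moreover $T\le C_2\max\{1,(\gamma/\mu)^{2/(3p+1)}\}$, and the total number of iterations satisfies $TS\le C_2\max\{1,(\gamma/\mu)^{2/(3p+1)}\}$ if $\Delta\le 2\epsilon$ and $TS\le C_2\max\{1,(\gamma/\mu)^{2/(3p+1)}\}\log_2(\Delta/\epsilon)$ if $\Delta>2\epsilon$. -/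

import Mathlib

noncomputable section

namespace AIPE


variable {E : Type*} [NormedAddCommGroup E] [InnerProductSpace ℝ E]

/-- The normal cone of `Z` at `z`. -/
def normalCone (Z : Set E) (z : E) : Set E :=
  {u | ∀ w ∈ Z, inner ℝ u (w - z) ≤ 0}

/-- The Euclidean projection onto `Z`: a point of `Z` nearest to `y` (it exists and is unique when
`Z` is nonempty, compact and convex). -/
def proj (Z : Set E) (y : E) : E :=
  Classical.epsilon fun w => w ∈ Z ∧ ∀ w' ∈ Z, ‖y - w‖ ≤ ‖y - w'‖

theorem proj_spec {Z : Set E} (hZ : IsCompact Z) (hne : Z.Nonempty) (y : E) :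
    proj Z y ∈ Z ∧ ∀ w' ∈ Z, ‖y - proj Z y‖ ≤ ‖y - w'‖ := by
  obtain ⟨w, hw, hmin⟩ := hZ.exists_isMinOn hne
    (f := fun w => ‖y - w‖) (by fun_prop)
  exact Classical.epsilon_spec
    (p := fun w => w ∈ Z ∧ ∀ w' ∈ Z, ‖y - w‖ ≤ ‖y - w'‖) ⟨w, hw, fun w' hw' => hmin hw'⟩

/-- `q`-th-order `μ`-uniform convexity on `Z` of a function `h` with gradient field `grad`. -/
def UniformlyConvexOn (q : ℕ) (μ : ℝ) (Z : Set E) (h : E → ℝ) (grad : E → E) : Prop :=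
  ∀ z ∈ Z, ∀ z' ∈ Z,
    h z' + inner ℝ (grad z') (z - z') + μ / q * ‖z - z'‖ ^ q ≤ h z

/-- `iFunc` is a `δ`-zeroth-order oracle of `h` on `Z`. -/
def IsZerothOrderOracle (Z : Set E) (h : E → ℝ) (δ : ℝ) (iFunc : E → ℝ) : Prop :=
  ∀ z ∈ Z, |iFunc z - h z| ≤ δ

/-- `iGrad` is a `δ`-first-order oracle on `Z` of a function with gradient field `grad`. -/
def IsFirstOrderOracle (Z : Set E) (grad : E → E) (δ : ℝ) (iGrad : E → E) : Prop :=
  ∀ z ∈ Z, ‖iGrad z - grad z‖ ≤ δ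

/-- The proximal weight `λ = γ ‖z - zbar‖ ^ (p - 1)`. -/
def proxWeight (p : ℕ) (γ : ℝ) (z zbar : E) : ℝ := γ * ‖z - zbar‖ ^ (p - 1)

/-- `iProx` is a `(δ, γ)`-`p`-th-order proximal oracle on `Z`: at `zbar` it returns a pair `(z, u)`
with `z ∈ Z`, `u` in the normal cone at `z`, and
`‖∇h(z) + u + λ (z - zbar)‖ ≤ (λ / 2) ‖z - zbar‖ + δ`. -/
def IsProxOracle (p : ℕ) (Z : Set E) (grad : E → E) (δ γ : ℝ) (iProx : E → E × E) : Prop :=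
  ∀ zbar ∈ Z,
    (iProx zbar).1 ∈ Z ∧ (iProx zbar).2 ∈ normalCone Z (iProx zbar).1 ∧
      ‖grad (iProx zbar).1 + (iProx zbar).2
          + proxWeight p γ (iProx zbar).1 zbar • ((iProx zbar).1 - zbar)‖
        ≤ proxWeight p γ (iProx zbar).1 zbar / 2 * ‖(iProx zbar).1 - zbar‖ + δ

/-- The positive solution `a` of `A + a = 2 * lam * a ^ 2`. -/
def stepRoot (A lam : ℝ) : ℝ := (1 + √(1 + 8 * lam * A)) / (4 * lam)

theorem stepRoot_iff {A lam : ℝ} (hA : 0 ≤ A) (hl : 0 < lam) (a : ℝ) :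
    (0 < a ∧ A + a = 2 * lam * a ^ 2) ↔ a = stepRoot A lam := by
  have hs : √(1 + 8 * lam * A) ^ 2 = 1 + 8 * lam * A := Real.sq_sqrt (by positivity)
  have hs1 : 0 ≤ √(1 + 8 * lam * A) := Real.sqrt_nonneg _
  unfold stepRoot
  constructor
  · rintro ⟨ha, h⟩
    have hge : 1 ≤ 4 * lam * a := by
      have : a * 1 ≤ a * (2 * lam * a) := by nlinarith
      have := le_of_mul_le_mul_left this ha
      nlinarith [mul_pos hl ha]
    have : √(1 + 8 * lam * A) = 4 * lam * a - 1 := by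
      rw [show 1 + 8 * lam * A = (4 * lam * a - 1) ^ 2 by
        rw [show A = 2 * lam * a ^ 2 - a by linarith]; ring]
      exact Real.sqrt_sq (by linarith)
    rw [this]; field_simp; ring
  · rintro rfl
    refine ⟨by positivity, ?_⟩
    generalize √(1 + 8 * lam * A) = r at hs hs1
    obtain rfl : A = (r ^ 2 - 1) / (8 * lam) := by
      rw [eq_div_iff (by positivity)]; linarith
    field_simp
    ring

/-- The variables carried from one inner iteration to the next: `z = z_t`, `zt = z̃_t`, `v = v_t`,
`A = A_t`, and `lamP = λ'_{t+1}`. -/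
structure State (E : Type*) where
  z : E
  zt : E
  v : E
  A : ℝ
  lamP : ℝ

/-- Start of an epoch at `z0`: `z_0 = v_0 = z0`, `A_0 = 0`, and `λ'_1 = λ_1`. Since `z_0 = v_0`, the
first prox centre is `z0` whatever the value of `a'_1`, so `λ_1` is known before `a'_1` is computed.
There is no prox output before the first iteration; by convention `z̃_0 = z0`. -/
def init (p : ℕ) (γ : ℝ) (iProx : E → E × E) (z0 : E) : State E where
  z := z0
  zt := z0
  v := z0
  A := 0
  lamP := proxWeight p γ (iProx z0).1 z0

/-- One inner iteration of the search-free Monteiro–Svaiter acceleration. -/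
def step (p : ℕ) (γ : ℝ) (Z : Set E) (iGrad : E → E) (iProx : E → E × E) (x : State E) :
    State E :=
  let aP := stepRoot x.A x.lamP
  let AP := x.A + aP
  let zbar := (x.A / AP) • x.z + (aP / AP) • x.v
  let zt := (iProx zbar).1
  let u := (iProx zbar).2
  let lam := proxWeight p γ zt zbar
  let θ := if lam ≤ x.lamP then 1 else x.lamP / lam
  let a := θ * aP
  let A := x.A + a
  { z := ((1 - θ) * x.A / A) • x.z + (θ * AP / A) • zt
    zt := zt
    v := proj Z (x.v - a • (iGrad zt + u))
    A := A
    lamP := if lam ≤ x.lamP then x.lamP / 2 else 2 * x.lamP }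

/-- The state after `t` inner iterations of an epoch started at `z0`. -/
def epochState (p : ℕ) (γ : ℝ) (Z : Set E) (iGrad : E → E) (iProx : E → E × E) (z0 : E) (t : ℕ) :
    State E :=
  (step p γ Z iGrad iProx)^[t] (init p γ iProx z0)

/-- The number of inner iterations completed in an epoch: `T`, unless `λ_1 = 0`. In that case the
equation for `a'_1` has no positive solution and the epoch is broken off; the only points generated
are then `z_0` and `z̃_1`, and these are both equal to `z0`. -/
def epochLength (p : ℕ) (γ : ℝ) (iProx : E → E × E) (T : ℕ) (z0 : E) : ℕ :=
  open Classical in if (init p γ iProx z0).lamP = 0 then 0 else T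

/-- The points `z_t` and `z̃_t` among which the result of an epoch is selected. -/
def candidates (p : ℕ) (γ : ℝ) (Z : Set E) (iGrad : E → E) (iProx : E → E × E) (T : ℕ) (z0 : E) :
    Set E :=
  {w | ∃ t ≤ epochLength p γ iProx T z0,
    w = (epochState p γ Z iGrad iProx z0 t).z ∨ w = (epochState p γ Z iGrad iProx z0 t).zt}

/-- `z1` is a possible result of an epoch of length `T` started at `z0`: a candidate with the lowest
recorded value (ties may be broken in any way). -/
def IsEpochOutput (p : ℕ) (γ : ℝ) (Z : Set E) (iFunc : E → ℝ) (iGrad : E → E) (iProx : E → E × E)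
    (T : ℕ) (z0 z1 : E) : Prop :=
  z1 ∈ candidates p γ Z iGrad iProx T z0 ∧
    ∀ w ∈ candidates p γ Z iGrad iProx T z0, iFunc z1 ≤ iFunc w

/-- `zs 0, …, zs S` are the restart points of a run of AIPE-restart from `z0` with `S` epochs of
length `T`; the run returns `zs S`. -/
def IsRun (p : ℕ) (γ : ℝ) (Z : Set E) (iFunc : E → ℝ) (iGrad : E → E) (iProx : E → E × E)
    (T S : ℕ) (z0 : E) (zs : ℕ → E) : Prop :=
  zs 0 = z0 ∧ ∀ s < S, IsEpochOutput p γ Z iFunc iGrad iProx T (zs s) (zs (s + 1))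

/-- The algorithm always runs to completion. -/
theorem exists_isRun (p : ℕ) (γ : ℝ) (Z : Set E) (iFunc : E → ℝ) (iGrad : E → E)
    (iProx : E → E × E) (T S : ℕ) (z0 : E) :
    ∃ zs, IsRun p γ Z iFunc iGrad iProx T S z0 zs := by
  have h : ∀ x, ∃ y, IsEpochOutput p γ Z iFunc iGrad iProx T x y := by
    intro x
    have hfin : (candidates p γ Z iGrad iProx T x).Finite := by
      refine ((Set.finite_Iic (epochLength p γ iProx T x)).biUnion fun t _ =>
        Set.toFinite {(epochState p γ Z iGrad iProx x t).z,
          (epochState p γ Z iGrad iProx x t).zt}).subset ?_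
      rintro w ⟨t, ht, hw⟩
      simp only [Set.mem_iUnion, Set.mem_Iic, Set.mem_insert_iff, Set.mem_singleton_iff]
      exact ⟨t, ht, hw⟩
    obtain ⟨y, hy, hmin⟩ := Set.exists_min_image _ iFunc hfin ⟨_, 0, Nat.zero_le _, Or.inl rfl⟩
    exact ⟨y, hy, hmin⟩
  choose f hf using h
  refine ⟨fun s => f^[s] z0, rfl, fun s _ => ?_⟩
  simp only [Function.iterate_succ_apply']
  exact hf _

/-- The admissible size of the oracle error. -/
def errorThreshold (p : ℕ) (μ D Δ ε : ℝ) : ℝ :=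
  min
    ((1 + √17) * ε ^ 2 * min D (((p + 1) * ε ^ 2 / (2 * μ * Δ)) ^ (1 / ((p : ℝ) + 1)))
      / (2 ^ 7 * (7 + √6) * D ^ 2 * Δ))
    (ε ^ 2 / (2 ^ 4 * max D 1 * Δ))

/-- The rate `(γ / μ) ^ (2 / (3 p + 1))`. -/
def rate (p : ℕ) (γ μ : ℝ) : ℝ := (γ / μ) ^ (2 / (3 * (p : ℝ) + 1))

/-- The number of epochs `S = ⌈log₂ (Δ / ε)⌉` (and `0` if `Δ ≤ ε`). -/
def numEpochs (Δ ε : ℝ) : ℕ := ⌈Real.logb 2 (Δ / ε)⌉₊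

end AIPE

end

/-!
Let `r_t` be the distance covered by the `t`-th proximal step of an epoch. Every iteration lowers
the Lyapunov function `A_t (h z_t - h z*) + ‖v_t - z*‖² / 2` by at least `3/16` of its movement
`A'_{t+1} min(λ_{t+1}, λ'_{t+1}) r_t²`, up to the oracle error, unless the proximal step is so
short that `z̃_{t+1}` is already nearly optimal. Hence, with `R = ‖z_0 - z*‖`, either the final gap
is small compared with `R² / A_T`, or the total movement is `O(R²)`.

In the latter case `A_T γ R^(p-1)` is at least a multiple of `T^((3p+1)/2)`. If few iterations
underestimate the proximal weight, `λ'` is halved so often that `A`, which stays above `1 / (4 λ')`,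
grows exponentially. Otherwise put `σ = 1 / (p + 1)`: the potential
`A^σ - σ/2 * A^(σ - 1/2) / √λ'` grows at every underestimating iteration by a multiple of
`A^(σ - 1/2) / √λ'`, which is bounded below by a negative power of the movement of that iteration.
Jensen's inequality and the bound on the total movement conclude.

Uniform convexity bounds `R^(p+1)` by a multiple of `(h z_0 - h z*) / μ`, so that `T` of the order
of `(γ / μ)^(2/(3p+1))` makes `A_T (h z_0 - h z*)` exceed `4 R²`: the epoch at least halves the gap
until it is of the order of `ε`.
-/

namespace AIPE

/-! ### Powers and sums -/

theorem one_add_mul_sub_one_le_rpow {x b : ℝ} (hx : 0 < x) (hb : b ≤ 0) :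
    1 + b * (x - 1) ≤ x ^ b := by
  rw [Real.rpow_def_of_pos hx]
  linarith [Real.add_one_le_exp (Real.log x * b),
    mul_le_mul_of_nonpos_left (Real.log_le_sub_one_of_pos hx) hb]

theorem card_mul_rpow_le_sum_rpow {ι : Type*} {s : Finset ι} {f : ι → ℝ} {b S : ℝ} (hb : b ≤ 0)
    (hf : ∀ i ∈ s, 0 < f i) (hS : 0 < S) (hsum : ∑ i ∈ s, f i ≤ S) :
    s.card * (S / s.card) ^ b ≤ ∑ i ∈ s, f i ^ b := by
  rcases s.eq_empty_or_nonempty with rfl | hs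
  · simp
  have hcard : (0 : ℝ) < s.card := by exact_mod_cast hs.card_pos
  set m := S / s.card with hm
  have hm0 : 0 < m := by positivity
  have tangent : ∀ i ∈ s, m ^ b * (1 + b * (f i / m - 1)) ≤ f i ^ b := fun i hi ↦ by
    calc m ^ b * (1 + b * (f i / m - 1)) ≤ m ^ b * (f i / m) ^ b := by
          gcongr; exact one_add_mul_sub_one_le_rpow (div_pos (hf i hi) hm0) hb
      _ = f i ^ b := by
          rw [← Real.mul_rpow hm0.le (div_pos (hf i hi) hm0).le, mul_div_cancel₀ _ hm0.ne']
  have hmean : (∑ i ∈ s, f i) / m ≤ s.card := by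
    rwa [div_le_iff₀ hm0, hm, mul_div_cancel₀ _ hcard.ne']
  calc s.card * m ^ b ≤ m ^ b * (s.card + b * ((∑ i ∈ s, f i) / m - s.card)) := by
        rw [mul_comm]
        gcongr
        exact le_add_of_nonneg_right (mul_nonneg_of_nonpos_of_nonpos hb (sub_nonpos.2 hmean))
    _ = ∑ i ∈ s, m ^ b * (1 + b * (f i / m - 1)) := by
        simp only [← Finset.mul_sum, Finset.sum_add_distrib, Finset.sum_sub_distrib,
          ← Finset.sum_div, Finset.sum_const, nsmul_eq_mul, mul_one]
    _ ≤ ∑ i ∈ s, f i ^ b := Finset.sum_le_sum tangent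

theorem rpow_sub_add_le_rpow {x y σ : ℝ} (hσ0 : 0 ≤ σ) (hσ1 : σ ≤ 1) (hy : 0 < y) (hyx : y ≤ x) :
    (x - y) ^ σ + σ * (y * x ^ (σ - 1)) ≤ x ^ σ := by
  have hx : 0 < x := hy.trans_le hyx
  have hratio : y / x ≤ 1 := (div_le_one hx).2 hyx
  have bernoulli := rpow_one_add_le_one_add_mul_self (s := -(y / x)) (by linarith) hσ0 hσ1
  calc (x - y) ^ σ + σ * (y * x ^ (σ - 1))
      = x ^ σ * (1 + -(y / x)) ^ σ + σ * (y * x ^ (σ - 1)) := by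
        rw [← Real.mul_rpow hx.le (by linarith)]; congr 2; field_simp; ring
    _ ≤ x ^ σ * (1 + σ * -(y / x)) + σ * (y * x ^ (σ - 1)) := by gcongr
    _ = x ^ σ := by rw [Real.rpow_sub_one hx.ne']; ring

theorem pow_le_two_pow_mul_factorial_mul_two_pow (n k : ℕ) :
    n ^ k ≤ 2 ^ k * k.factorial * 2 ^ n :=
  calc n ^ k ≤ (n + 1) ^ k := Nat.pow_le_pow_left n.le_succ k
    _ ≤ (n + 1).ascFactorial k := Nat.pow_succ_le_ascFactorial _ _
    _ = k.factorial * (n + k).choose k := Nat.ascFactorial_eq_factorial_mul_choose n k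
    _ ≤ k.factorial * 2 ^ (n + k) := Nat.mul_le_mul_left _ (Nat.choose_le_two_pow _ _)
    _ = 2 ^ k * k.factorial * 2 ^ n := by ring

/-! ### Growth of the weights -/

section Gain

variable {σ A B L : ℝ}

/-- The derivative of `A ^ σ` along a full step (up to a constant): if the trial step from `A` with
proximal weight `L` ends at `B`, then `B ^ σ` exceeds `A ^ σ` by a multiple of `gain σ B L`. -/
noncomputable def gain (σ A L : ℝ) : ℝ := A ^ (σ - 1 / 2) / √L

theorem gain_nonneg (σ : ℝ) (hA : 0 ≤ A) (L : ℝ) : 0 ≤ gain σ A L := by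
  unfold gain; positivity

theorem gain_two_mul_le (hσ : σ ≤ 1 / 2) (hA : 0 < A) (hAB : A ≤ B) :
    gain σ B (2 * L) ≤ 3 / 4 * gain σ A L := by
  have hsqrt : 3 / 4 * √2 ≥ 1 := by
    linarith [show (4 / 3 : ℝ) ≤ √2 from Real.le_sqrt_of_sq_le (by norm_num)]
  calc gain σ B (2 * L) ≤ gain σ A (2 * L) :=
        div_le_div_of_nonneg_right (Real.rpow_le_rpow_of_nonpos hA hAB (by linarith))
          (Real.sqrt_nonneg _)
    _ ≤ 3 / 4 * √2 * gain σ A (2 * L) := le_mul_of_one_le_left (gain_nonneg σ hA.le _) hsqrt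
    _ = 3 / 4 * gain σ A L := by
        rw [gain, gain, Real.sqrt_mul zero_le_two]; field_simp

theorem rpow_add_gain_le_rpow {a : ℝ} (hσ0 : 0 ≤ σ) (hσ1 : σ ≤ 1) (hA : 0 ≤ A) (ha : 0 < a)
    (hL : 0 < L) (hroot : A + a = 2 * L * a ^ 2) :
    A ^ σ + σ / 2 * gain σ (A + a) (L / 2) ≤ (A + a) ^ σ := by
  have hB : 0 < A + a := by positivity
  have hsqrt : √(A + a) = 2 * a * √(L / 2) := by
    rw [← Real.sqrt_sq (show 0 ≤ 2 * a by positivity), ← Real.sqrt_mul (sq_nonneg _), hroot]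
    congr 1; ring
  have hgain : gain σ (A + a) (L / 2) = 2 * (a * (A + a) ^ (σ - 1)) := by
    rw [gain, show σ - 1 / 2 = σ - 1 + 1 / 2 by ring, Real.rpow_add hB, ← Real.sqrt_eq_rpow, hsqrt]
    field_simp
  have := rpow_sub_add_le_rpow hσ0 hσ1 ha (show a ≤ A + a by linarith)
  rw [add_sub_cancel_right] at this
  rw [hgain]
  linarith

/-- An underestimated proximal weight is paid for by the distance `r` that the step covers. -/
theorem rpow_mul_rpow_le_gain {p : ℕ} {a γ r : ℝ} (hp : 1 ≤ p) (hA : 0 < A) (ha : 0 ≤ a)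
    (hL : 0 < L) (hγ : 0 < γ) (hr : 0 < r) (hLr : L ≤ γ * r ^ (p - 1)) :
    γ ^ (-(1 / ((p : ℝ) + 1))) * ((A + a) * L * r ^ 2) ^ (1 / ((p : ℝ) + 1) - 1 / 2)
      ≤ gain (1 / ((p : ℝ) + 1)) A L := by
  set σ : ℝ := 1 / ((p : ℝ) + 1) with hσ
  have hp' : (1 : ℝ) ≤ p := by exact_mod_cast hp
  have hσ_nonneg : 0 ≤ σ := by positivity
  have hσ_half : σ - 1 / 2 ≤ 0 :=
    sub_nonpos.2 (one_div_le_one_div_of_le two_pos (by linarith))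
  have hrpow : (r ^ 2) ^ (σ - 1 / 2) = (r ^ (p - 1)) ^ (-σ) := by
    rw [← Real.rpow_natCast, ← Real.rpow_natCast, ← Real.rpow_mul hr.le, ← Real.rpow_mul hr.le,
      Nat.cast_sub hp, hσ]
    congr 1; push_cast; field_simp; ring
  have hL_half : L ^ (σ - 1 / 2) * L ^ (-σ) = (√L)⁻¹ := by
    rw [← Real.rpow_add hL, Real.sqrt_eq_rpow, ← Real.rpow_neg hL.le]
    congr 1; ring
  calc γ ^ (-σ) * ((A + a) * L * r ^ 2) ^ (σ - 1 / 2)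
      ≤ γ ^ (-σ) * (A * L * r ^ 2) ^ (σ - 1 / 2) := by
        refine mul_le_mul_of_nonneg_left
          (Real.rpow_le_rpow_of_nonpos (by positivity) ?_ hσ_half) (by positivity)
        gcongr; linarith
    _ = A ^ (σ - 1 / 2) * L ^ (σ - 1 / 2) * (γ * r ^ (p - 1)) ^ (-σ) := by
        rw [Real.mul_rpow (by positivity) (by positivity), Real.mul_rpow hA.le hL.le, hrpow,
          Real.mul_rpow hγ.le (by positivity)]
        ring
    _ ≤ A ^ (σ - 1 / 2) * L ^ (σ - 1 / 2) * L ^ (-σ) :=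
        mul_le_mul_of_nonneg_left (Real.rpow_le_rpow_of_nonpos hL hLr (by linarith))
          (by positivity)
    _ = gain σ A L := by rw [gain, mul_assoc, hL_half, ← div_eq_mul_inv]

end Gain

theorem half_le_mul_of_root {A a L : ℝ} (hA : 0 ≤ A) (ha : 0 < a)
    (hroot : A + a = 2 * L * a ^ 2) : 1 / 2 ≤ (A + a) * L := by
  have hLa : 1 ≤ 2 * L * a := le_of_mul_le_mul_right (by nlinarith) ha
  rw [hroot]
  nlinarith

/-- The scalar quantities of `n` search-free iterations started at `A 0 = 0`: the guessed proximal
weights `L` (the paper's `λ'`), the trial steps `a` (the paper's `a'`), the weights `A` and the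
distances `r` covered by the proximal steps, so that `γ * r t ^ (p - 1)` is the true proximal
weight. -/
structure IsSearchFreeSeq (p : ℕ) (γ : ℝ) (n : ℕ) (A L a r : ℕ → ℝ) : Prop where
  A_zero : A 0 = 0
  L_zero : L 0 = γ * r 0 ^ (p - 1)
  a_pos : ∀ t < n, 0 < a t
  r_pos : ∀ t < n, 0 < r t
  root : ∀ t < n, A t + a t = 2 * L t * a t ^ 2
  down : ∀ t < n, γ * r t ^ (p - 1) ≤ L t → A (t + 1) = A t + a t ∧ L (t + 1) = L t / 2
  up : ∀ t < n, L t < γ * r t ^ (p - 1) → A t ≤ A (t + 1) ∧ L (t + 1) = 2 * L t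

/-- The iterations before `t` in which the proximal weight was underestimated. -/
noncomputable def upSteps (p : ℕ) (γ : ℝ) (L r : ℕ → ℝ) (t : ℕ) : Finset ℕ :=
  {s ∈ Finset.range t | L s < γ * r s ^ (p - 1)}

/-- The squared distance covered in iteration `t`, weighted as in the Lyapunov estimate. -/
noncomputable def movement (p : ℕ) (γ : ℝ) (A L a r : ℕ → ℝ) (t : ℕ) : ℝ :=
  (A t + a t) * min (γ * r t ^ (p - 1)) (L t) * r t ^ 2

section UpSteps

variable {p : ℕ} {γ : ℝ} {L r : ℕ → ℝ} {t : ℕ}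

theorem mem_upSteps {s : ℕ} : s ∈ upSteps p γ L r t ↔ s < t ∧ L s < γ * r s ^ (p - 1) := by
  simp only [upSteps, Finset.mem_filter, Finset.mem_range]

theorem notMem_upSteps_self (p : ℕ) (γ : ℝ) (L r : ℕ → ℝ) (t : ℕ) : t ∉ upSteps p γ L r t :=
  fun ht ↦ (mem_upSteps.1 ht).1.false

theorem upSteps_succ_of_lt (h : L t < γ * r t ^ (p - 1)) :
    upSteps p γ L r (t + 1) = insert t (upSteps p γ L r t) := by
  rw [upSteps, Finset.range_add_one, Finset.filter_insert, if_pos h, upSteps]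

theorem upSteps_succ_of_le (h : γ * r t ^ (p - 1) ≤ L t) :
    upSteps p γ L r (t + 1) = upSteps p γ L r t := by
  rw [upSteps, Finset.range_add_one, Finset.filter_insert, if_neg h.not_gt, upSteps]

end UpSteps

namespace IsSearchFreeSeq

variable {p : ℕ} {γ ρ : ℝ} {n t : ℕ} {A L a r : ℕ → ℝ}

theorem A_nonneg_and_L_pos (hs : IsSearchFreeSeq p γ n A L a r) (hγ : 0 < γ) (hn : 1 ≤ n)
    (ht : t ≤ n) : 0 ≤ A t ∧ 0 < L t := by
  induction t with
  | zero =>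
    have hr := hs.r_pos 0 hn
    rw [hs.A_zero, hs.L_zero]
    exact ⟨le_rfl, by positivity⟩
  | succ t ih =>
    obtain ⟨hA, hL⟩ := ih (by omega)
    have ha := hs.a_pos t ht
    rcases le_or_gt (γ * r t ^ (p - 1)) (L t) with h | h
    · obtain ⟨hA', hL'⟩ := hs.down t ht h
      rw [hA', hL']
      exact ⟨by positivity, by positivity⟩
    · obtain ⟨hA', hL'⟩ := hs.up t ht h
      rw [hL']
      exact ⟨hA.trans hA', by positivity⟩

theorem A_nonneg (hs : IsSearchFreeSeq p γ n A L a r) (hγ : 0 < γ) (hn : 1 ≤ n) (ht : t ≤ n) :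
    0 ≤ A t :=
  (hs.A_nonneg_and_L_pos hγ hn ht).1

theorem L_pos (hs : IsSearchFreeSeq p γ n A L a r) (hγ : 0 < γ) (hn : 1 ≤ n) (ht : t ≤ n) :
    0 < L t :=
  (hs.A_nonneg_and_L_pos hγ hn ht).2

theorem quarter_le_A_mul_L (hs : IsSearchFreeSeq p γ n A L a r) (hγ : 0 < γ) (ht : t < n) :
    1 / 4 ≤ A (t + 1) * L (t + 1) := by
  have hdown : ∀ s < n, γ * r s ^ (p - 1) ≤ L s → 1 / 4 ≤ A (s + 1) * L (s + 1) := by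
    intro s hsn h
    obtain ⟨hA, hL⟩ := hs.down s hsn h
    have := half_le_mul_of_root (hs.A_nonneg hγ (by omega) hsn.le) (hs.a_pos s hsn) (hs.root s hsn)
    rw [hA, hL]
    linarith
  induction t with
  | zero => exact hdown 0 ht hs.L_zero.ge
  | succ t ih =>
    rcases le_or_gt (γ * r (t + 1) ^ (p - 1)) (L (t + 1)) with h | h
    · exact hdown _ ht h
    · obtain ⟨hA, hL⟩ := hs.up _ ht h
      have hmul := mul_le_mul_of_nonneg_right hA (hs.L_pos hγ (by omega) ht.le).le
      rw [hL]
      linarith [ih (by omega)]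

theorem A_pos (hs : IsSearchFreeSeq p γ n A L a r) (hγ : 0 < γ) (ht0 : t ≠ 0) (ht : t ≤ n) :
    0 < A t := by
  obtain ⟨s, rfl⟩ := Nat.exists_eq_succ_of_ne_zero ht0
  have := hs.quarter_le_A_mul_L hγ ht
  exact pos_of_mul_pos_left (by linarith) (hs.L_pos hγ (by omega) ht).le

theorem movement_pos (hs : IsSearchFreeSeq p γ n A L a r) (hγ : 0 < γ) (ht : t < n) :
    0 < movement p γ A L a r t := by
  have hA := hs.A_nonneg hγ (by omega) ht.le
  have ha := hs.a_pos t ht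
  have hr := hs.r_pos t ht
  have hmin : 0 < min (γ * r t ^ (p - 1)) (L t) :=
    lt_min (by positivity) (hs.L_pos hγ (by omega) ht.le)
  unfold movement; positivity

/-- Weights grow exponentially unless many iterations underestimate: `L` halves in every other
iteration, while `A * L` stays bounded below. -/
theorem L_mul_two_pow (hs : IsSearchFreeSeq p γ n A L a r) (ht : t ≤ n) :
    L t * 2 ^ t = L 0 * 4 ^ (upSteps p γ L r t).card := by
  induction t with
  | zero => simp [upSteps]
  | succ t ih =>
    have ih := ih (by omega)
    rcases le_or_gt (γ * r t ^ (p - 1)) (L t) with h | h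
    · rw [(hs.down t ht h).2, upSteps_succ_of_le h, ← ih]
      ring
    · rw [(hs.up t ht h).2, upSteps_succ_of_lt h,
        Finset.card_insert_of_notMem (notMem_upSteps_self p γ L r t), pow_succ 4, ← mul_assoc, ← ih]
      ring

theorem r_zero_le (hs : IsSearchFreeSeq p γ n A L a r) (hγ : 0 < γ) (hn : 1 ≤ n) (hρ : 0 ≤ ρ)
    (hsum : ∑ t ∈ Finset.range n, movement p γ A L a r t ≤ ρ ^ 2) : r 0 ≤ 2 * ρ := by
  have hroot := half_le_mul_of_root hs.A_zero.ge (hs.a_pos 0 hn) (hs.root 0 hn)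
  have hmov : (A 0 + a 0) * L 0 * r 0 ^ 2 ≤ ρ ^ 2 :=
    calc (A 0 + a 0) * L 0 * r 0 ^ 2 = movement p γ A L a r 0 := by
          rw [movement, min_eq_right hs.L_zero.le]
      _ ≤ ∑ t ∈ Finset.range n, movement p γ A L a r t :=
          Finset.single_le_sum (fun t ht ↦ (hs.movement_pos hγ (Finset.mem_range.1 ht)).le)
            (Finset.mem_range.2 hn)
      _ ≤ ρ ^ 2 := hsum
  refine le_of_sq_le_sq ?_ (by positivity)
  nlinarith [mul_le_mul_of_nonneg_right hroot (sq_nonneg (r 0)), sq_nonneg ρ]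

theorem two_pow_le (hs : IsSearchFreeSeq p γ n A L a r) (hγ : 0 < γ) (hn : 1 ≤ n) (hρ : 0 ≤ ρ)
    (hsum : ∑ t ∈ Finset.range n, movement p γ A L a r t ≤ ρ ^ 2) :
    2 ^ n ≤ 4 * 2 ^ (p - 1) * 4 ^ (upSteps p γ L r n).card * (A n * γ * ρ ^ (p - 1)) := by
  obtain ⟨k, rfl⟩ : ∃ k, n = k + 1 := ⟨n - 1, by omega⟩
  have hAL := hs.quarter_le_A_mul_L hγ k.lt_succ_self
  have hA := hs.A_nonneg hγ hn le_rfl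
  have hr := hs.r_pos 0 hn
  have hL0 : L 0 ≤ γ * (2 ^ (p - 1) * ρ ^ (p - 1)) := by
    rw [hs.L_zero, ← mul_pow]
    gcongr
    exact hs.r_zero_le hγ hn hρ hsum
  calc (2 : ℝ) ^ (k + 1) ≤ 4 * (A (k + 1) * L (k + 1)) * 2 ^ (k + 1) :=
        le_mul_of_one_le_left (by positivity) (by linarith)
    _ = 4 * A (k + 1) * (L 0 * 4 ^ (upSteps p γ L r (k + 1)).card) := by
        rw [← hs.L_mul_two_pow le_rfl]; ring
    _ ≤ 4 * A (k + 1) * (γ * (2 ^ (p - 1) * ρ ^ (p - 1)) * 4 ^ (upSteps p γ L r (k + 1)).card) := by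
        gcongr
    _ = _ := by ring

/-- The potential `A ^ σ - σ / 2 * gain σ A L` grows in every iteration: a full step raises
`A ^ σ` by at least the new value of the subtracted term, and an underestimating step shrinks that
term by a quarter. -/
theorem sum_gain_add_gain_le {σ : ℝ} (hs : IsSearchFreeSeq p γ n A L a r) (hγ : 0 < γ)
    (hσ0 : 0 ≤ σ) (hσ : σ ≤ 1 / 2) (ht : t < n) :
    σ / 8 * ∑ s ∈ upSteps p γ L r (t + 1), gain σ (A s) (L s)
      + σ / 2 * gain σ (A (t + 1)) (L (t + 1)) ≤ A (t + 1) ^ σ := by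
  have hfull : ∀ s < n, γ * r s ^ (p - 1) ≤ L s →
      A s ^ σ + σ / 2 * gain σ (A (s + 1)) (L (s + 1)) ≤ A (s + 1) ^ σ := by
    intro s hsn h
    obtain ⟨hA, hL⟩ := hs.down s hsn h
    rw [hA, hL]
    exact rpow_add_gain_le_rpow hσ0 (by linarith) (hs.A_nonneg hγ (by omega) hsn.le)
      (hs.a_pos s hsn) (hs.L_pos hγ (by omega) hsn.le) (hs.root s hsn)
  induction t with
  | zero =>
    have hA0 : 0 ≤ A 0 ^ σ := by rw [hs.A_zero]; positivity
    rw [upSteps_succ_of_le hs.L_zero.ge]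
    simp only [upSteps, Finset.range_zero, Finset.filter_empty, Finset.sum_empty, mul_zero]
    linarith [hfull 0 ht hs.L_zero.ge]
  | succ t ih =>
    have ih := ih (by omega)
    rcases le_or_gt (γ * r (t + 1) ^ (p - 1)) (L (t + 1)) with h | h
    · have hgain := mul_nonneg (show 0 ≤ σ / 2 by linarith)
        (gain_nonneg σ (hs.A_nonneg hγ (by omega) ht.le) (L (t + 1)))
      rw [upSteps_succ_of_le h]
      linarith [hfull _ ht h]
    · obtain ⟨hA, hL⟩ := hs.up _ ht h
      have hApos := hs.A_pos hγ t.succ_ne_zero ht.le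
      have hgain := mul_le_mul_of_nonneg_left (gain_two_mul_le (L := L (t + 1)) hσ hApos hA)
        (show 0 ≤ σ / 2 by linarith)
      have hmono := Real.rpow_le_rpow hApos.le hA hσ0
      rw [upSteps_succ_of_lt h, Finset.sum_insert (notMem_upSteps_self p γ L r (t + 1)), hL]
      linarith

theorem card_upSteps_mul_rpow_le (hs : IsSearchFreeSeq p γ n A L a r) (hp : 1 ≤ p) (hγ : 0 < γ)
    (hn : 1 ≤ n) (hρ : 0 < ρ) (hsum : ∑ t ∈ Finset.range n, movement p γ A L a r t ≤ ρ ^ 2) :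
    γ ^ (-(1 / ((p : ℝ) + 1))) * ((upSteps p γ L r n).card
        * (ρ ^ 2 / (upSteps p γ L r n).card) ^ (1 / ((p : ℝ) + 1) - 1 / 2))
      ≤ 8 * (p + 1) * A n ^ (1 / ((p : ℝ) + 1)) := by
  set U := upSteps p γ L r n
  set σ : ℝ := 1 / ((p : ℝ) + 1) with hσ
  have hp' : (1 : ℝ) ≤ p := by exact_mod_cast hp
  have hσ0 : 0 < σ := by positivity
  have hσ_half : σ ≤ 1 / 2 := one_div_le_one_div_of_le two_pos (by linarith)
  have hmovU : ∀ s ∈ U, 0 < movement p γ A L a r s := fun s hsU ↦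
    hs.movement_pos hγ (mem_upSteps.1 hsU).1
  have hsumU : ∑ s ∈ U, movement p γ A L a r s ≤ ρ ^ 2 :=
    (Finset.sum_le_sum_of_subset_of_nonneg (Finset.filter_subset _ _) fun s hsn _ ↦
      (hs.movement_pos hγ (Finset.mem_range.1 hsn)).le).trans hsum
  have hgain : ∀ s ∈ U, γ ^ (-σ) * movement p γ A L a r s ^ (σ - 1 / 2) ≤ gain σ (A s) (L s) := by
    intro s hsU
    obtain ⟨hsn, hup⟩ := mem_upSteps.1 hsU
    have hs0 : s ≠ 0 := by rintro rfl; exact hup.ne hs.L_zero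
    rw [movement, min_eq_right hup.le]
    exact rpow_mul_rpow_le_gain hp (hs.A_pos hγ hs0 hsn.le) (hs.a_pos s hsn).le
      (hs.L_pos hγ hn hsn.le) hγ (hs.r_pos s hsn) hup.le
  have hpotential : σ / 8 * ∑ s ∈ U, gain σ (A s) (L s) ≤ A n ^ σ := by
    obtain ⟨k, rfl⟩ : ∃ k, n = k + 1 := ⟨n - 1, by omega⟩
    have := mul_nonneg (show 0 ≤ σ / 2 by linarith)
      (gain_nonneg σ (hs.A_nonneg hγ hn le_rfl) (L (k + 1)))
    linarith [hs.sum_gain_add_gain_le hγ hσ0.le hσ_half k.lt_succ_self]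
  calc γ ^ (-σ) * (U.card * (ρ ^ 2 / U.card) ^ (σ - 1 / 2))
      ≤ γ ^ (-σ) * ∑ s ∈ U, movement p γ A L a r s ^ (σ - 1 / 2) := by
        gcongr; exact card_mul_rpow_le_sum_rpow (by linarith) hmovU (by positivity) hsumU
    _ ≤ ∑ s ∈ U, gain σ (A s) (L s) := by rw [Finset.mul_sum]; exact Finset.sum_le_sum hgain
    _ = 8 * (p + 1) * (σ / 8 * ∑ s ∈ U, gain σ (A s) (L s)) := by rw [hσ]; field_simp
    _ ≤ 8 * (p + 1) * A n ^ σ := by gcongr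

end IsSearchFreeSeq

theorem pow_le_of_mul_rpow_le {p : ℕ} {u γ ρ κ A : ℝ} (hp : 1 ≤ p) (hu : 0 < u) (hγ : 0 < γ)
    (hρ : 0 < ρ) (hA : 0 ≤ A)
    (h : γ ^ (-(1 / ((p : ℝ) + 1))) * (u * (ρ ^ 2 / u) ^ (1 / ((p : ℝ) + 1) - 1 / 2))
      ≤ κ * A ^ (1 / ((p : ℝ) + 1))) :
    u ^ (3 * p + 1) ≤ κ ^ (2 * (p + 1)) * (A * γ * ρ ^ (p - 1)) ^ 2 := by
  have hrpow_pow : ∀ {x e : ℝ}, 0 < x → ∀ k : ℤ, e * (2 * (p + 1)) = k →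
      (x ^ e) ^ (2 * (p + 1)) = x ^ k := by
    intro x e hx k hk
    rw [← Real.rpow_natCast, ← Real.rpow_mul hx.le, ← Real.rpow_intCast, ← hk]
    push_cast; rfl
  have hγpow : (γ ^ (-(1 / ((p : ℝ) + 1)))) ^ (2 * (p + 1)) = (γ ^ 2)⁻¹ := by
    rw [hrpow_pow hγ (-2) (by push_cast; field_simp)]; norm_cast
  have hmpow : ((ρ ^ 2 / u) ^ (1 / ((p : ℝ) + 1) - 1 / 2)) ^ (2 * (p + 1))
      = ((ρ ^ 2 / u) ^ (p - 1))⁻¹ := by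
    rw [hrpow_pow (by positivity) (-((p - 1 : ℕ) : ℤ))
      (by push_cast [hp]; field_simp; ring), zpow_neg, zpow_natCast]
  have hApow : (A ^ (1 / ((p : ℝ) + 1))) ^ (2 * (p + 1)) = A ^ 2 := by
    rw [← Real.rpow_natCast, ← Real.rpow_mul hA, ← Real.rpow_natCast A]
    congr 1; push_cast; field_simp
  have hpow := pow_le_pow_left₀ (by positivity) h (2 * (p + 1))
  rw [mul_pow, mul_pow, mul_pow κ, hγpow, hmpow, hApow] at hpow
  have hexp : u ^ (3 * p + 1) = u ^ (2 * (p + 1)) * u ^ (p - 1) := by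
    rw [← pow_add]; congr 1; omega
  calc u ^ (3 * p + 1)
      = (γ ^ 2)⁻¹ * (u ^ (2 * (p + 1)) * ((ρ ^ 2 / u) ^ (p - 1))⁻¹)
          * (γ ^ 2 * (ρ ^ 2) ^ (p - 1)) := by rw [hexp, div_pow]; field_simp
    _ ≤ κ ^ (2 * (p + 1)) * A ^ 2 * (γ ^ 2 * (ρ ^ 2) ^ (p - 1)) := by gcongr
    _ = κ ^ (2 * (p + 1)) * (A * γ * ρ ^ (p - 1)) ^ 2 := by rw [pow_right_comm]; ring

/-- The constant of the growth estimate `IsSearchFreeSeq.pow_le`. The two entries belong to runs in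
which more, respectively at most, a quarter of the iterations underestimate the proximal weight. -/
noncomputable def growthConst (p : ℕ) : ℝ :=
  max (4 ^ (3 * p + 1) * (8 * (p + 1)) ^ (2 * (p + 1)))
    (2 ^ (3 * p + 1) * (3 * p + 1).factorial * (4 * 2 ^ (p - 1)) ^ 2)

theorem growthConst_pos (p : ℕ) : 0 < growthConst p := lt_max_of_lt_left (by positivity)

theorem IsSearchFreeSeq.pow_le {p n : ℕ} {γ ρ : ℝ} {A L a r : ℕ → ℝ}
    (hs : IsSearchFreeSeq p γ n A L a r) (hp : 1 ≤ p) (hγ : 0 < γ) (hn : 1 ≤ n) (hρ : 0 < ρ)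
    (hsum : ∑ t ∈ Finset.range n, movement p γ A L a r t ≤ ρ ^ 2) :
    (n : ℝ) ^ (3 * p + 1) ≤ growthConst p * (A n * γ * ρ ^ (p - 1)) ^ 2 := by
  set u := (upSteps p γ L r n).card
  set X := A n * γ * ρ ^ (p - 1)
  rcases le_or_gt n (4 * u) with hmany | hfew
  · have hu : (0 : ℝ) < u := by exact_mod_cast (by omega : 0 < u)
    calc (n : ℝ) ^ (3 * p + 1) ≤ (4 * u) ^ (3 * p + 1) := by gcongr; exact_mod_cast hmany
      _ = 4 ^ (3 * p + 1) * u ^ (3 * p + 1) := mul_pow _ _ _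
      _ ≤ 4 ^ (3 * p + 1) * ((8 * (p + 1)) ^ (2 * (p + 1)) * X ^ 2) := by
          gcongr
          exact pow_le_of_mul_rpow_le hp hu hγ hρ (hs.A_nonneg hγ hn le_rfl)
            (hs.card_upSteps_mul_rpow_le hp hγ hn hρ hsum)
      _ = 4 ^ (3 * p + 1) * (8 * (p + 1)) ^ (2 * (p + 1)) * X ^ 2 := (mul_assoc _ _ _).symm
      _ ≤ growthConst p * X ^ 2 := by gcongr; exact le_max_left _ _
  · have hfour : ((4 : ℝ) ^ u) ^ 2 ≤ 2 ^ n := by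
      rw [show (4 : ℝ) = 2 ^ 2 by norm_num, ← pow_mul, ← pow_mul]
      exact pow_le_pow_right₀ one_le_two (by omega)
    have hexp : (2 : ℝ) ^ n ≤ (4 * 2 ^ (p - 1)) ^ 2 * X ^ 2 := by
      refine le_of_mul_le_mul_right ?_ (show (0 : ℝ) < 2 ^ n by positivity)
      calc (2 : ℝ) ^ n * 2 ^ n = (2 ^ n) ^ 2 := by ring
        _ ≤ (4 * 2 ^ (p - 1) * 4 ^ u * X) ^ 2 := by
            gcongr; exact hs.two_pow_le hγ hn hρ.le hsum
        _ = (4 * 2 ^ (p - 1)) ^ 2 * X ^ 2 * (4 ^ u) ^ 2 := by ring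
        _ ≤ (4 * 2 ^ (p - 1)) ^ 2 * X ^ 2 * 2 ^ n := by gcongr
    calc (n : ℝ) ^ (3 * p + 1) ≤ 2 ^ (3 * p + 1) * (3 * p + 1).factorial * 2 ^ n := by
          exact_mod_cast pow_le_two_pow_mul_factorial_mul_two_pow n (3 * p + 1)
      _ ≤ 2 ^ (3 * p + 1) * (3 * p + 1).factorial * ((4 * 2 ^ (p - 1)) ^ 2 * X ^ 2) := by gcongr
      _ = 2 ^ (3 * p + 1) * (3 * p + 1).factorial * (4 * 2 ^ (p - 1)) ^ 2 * X ^ 2 :=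
          (mul_assoc _ _ _).symm
      _ ≤ growthConst p * X ^ 2 := by gcongr; exact le_max_right _ _


/-! ### Uniform convexity, projections and proximal steps -/

namespace UniformlyConvexOn

variable {E : Type*} [NormedAddCommGroup E] [InnerProductSpace ℝ E] {q : ℕ} {μ : ℝ}
  {Z : Set E} {h : E → ℝ} {g : E → E} {x y z w u zstar : E}

theorem sub_le_inner_add (hh : UniformlyConvexOn q μ Z h g) (hμ : 0 ≤ μ) (hz : z ∈ Z)
    (hw : w ∈ Z) (hu : u ∈ normalCone Z z) : h z - h w ≤ inner ℝ (g z + u) (z - w) := by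
  have hconv := hh w hw z hz
  have hcone := hu w hw
  have hpow : 0 ≤ μ / q * ‖w - z‖ ^ q := by positivity
  rw [← neg_sub z w, inner_neg_right] at hconv hcone
  rw [neg_sub] at hconv
  rw [inner_add_left]
  linarith

theorem map_combo_add_le (hh : UniformlyConvexOn q μ Z h g) (hμ : 0 ≤ μ) (hZ : Convex ℝ Z)
    (hx : x ∈ Z) (hy : y ∈ Z) {a b : ℝ} (ha : 0 ≤ a) (hb : 0 ≤ b) (hab : a + b = 1) :
    h (a • x + b • y) + b * (μ / q * (a * ‖y - x‖) ^ q) ≤ a * h x + b * h y := by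
  set w := a • x + b • y with hw_def
  have hw : w ∈ Z := hZ hx hy ha hb hab
  have hxw : x - w = -b • (y - x) := by
    rw [hw_def, ← sub_eq_zero, show a = 1 - b by linarith]; module
  have hyw : y - w = a • (y - x) := by
    rw [hw_def, ← sub_eq_zero, show b = 1 - a by linarith]; module
  have hconv_x := mul_le_mul_of_nonneg_left (hh x hx w hw) ha
  have hconv_y := mul_le_mul_of_nonneg_left (hh y hy w hw) hb
  have hpow : 0 ≤ a * (μ / q * ‖x - w‖ ^ q) := by positivity
  rw [hxw, inner_smul_right] at hconv_x
  rw [hyw, inner_smul_right, norm_smul, Real.norm_of_nonneg ha] at hconv_y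
  rw [hxw] at hpow
  have hw_eq : h w = a * h w + b * h w := by rw [← add_mul, hab, one_mul]
  linarith

theorem map_combo_le (hh : UniformlyConvexOn q μ Z h g) (hμ : 0 ≤ μ) (hZ : Convex ℝ Z)
    (hx : x ∈ Z) (hy : y ∈ Z) {a b : ℝ} (ha : 0 ≤ a) (hb : 0 ≤ b) (hab : a + b = 1) :
    h (a • x + b • y) ≤ a * h x + b * h y :=
  (le_add_of_nonneg_right (by positivity)).trans (hh.map_combo_add_le hμ hZ hx hy ha hb hab)

theorem norm_pow_le (hh : UniformlyConvexOn q μ Z h g) (hμ : 0 ≤ μ) (hZ : Convex ℝ Z)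
    (hstar : zstar ∈ Z) (hz : z ∈ Z) (hmin : IsMinOn h Z zstar) :
    μ / q * ‖z - zstar‖ ^ q ≤ h z - h zstar := by
  have hsegment : ∀ t ∈ Set.Ioo (0 : ℝ) 1,
      μ / q * ((1 - t) * ‖z - zstar‖) ^ q ≤ h z - h zstar := by
    rintro t ⟨ht0, ht1⟩
    have ht1' : 0 ≤ 1 - t := by linarith
    have hcombo := hh.map_combo_add_le hμ hZ hstar hz ht1' ht0.le (sub_add_cancel 1 t)
    have hle : h zstar ≤ h ((1 - t) • zstar + t • z) :=
      hmin (hZ hstar hz ht1' ht0.le (sub_add_cancel 1 t))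
    exact le_of_mul_le_mul_left (by linarith) ht0
  have hlim : Filter.Tendsto (fun t : ℝ ↦ μ / q * ((1 - t) * ‖z - zstar‖) ^ q)
      (nhdsWithin 0 (Set.Ioi 0)) (nhds (μ / q * ((1 - 0) * ‖z - zstar‖) ^ q)) :=
    ((by fun_prop : Continuous _).tendsto 0).mono_left nhdsWithin_le_nhds
  rw [sub_zero, one_mul] at hlim
  exact le_of_tendsto hlim (Filter.eventually_of_mem (Ioo_mem_nhdsGT one_pos) hsegment)

end UniformlyConvexOn

section Projection

variable {E : Type*} [NormedAddCommGroup E] [InnerProductSpace ℝ E] {Z : Set E}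

theorem proj_mem_and_inner_le_zero (hZ : IsComplete Z) (hc : Convex ℝ Z) (hne : Z.Nonempty)
    (y : E) : proj Z y ∈ Z ∧ ∀ w ∈ Z, inner ℝ (y - proj Z y) (w - proj Z y) ≤ 0 := by
  have := hne.to_subtype
  have hbdd : BddBelow (Set.range fun w : Z ↦ ‖y - w‖) :=
    ⟨0, Set.forall_mem_range.2 fun _ ↦ norm_nonneg _⟩
  obtain ⟨w, hw, hmin⟩ := exists_norm_eq_iInf_of_complete_convex hne hZ hc y
  obtain ⟨hmem, hle⟩ := Classical.epsilon_spec
    (p := fun w ↦ w ∈ Z ∧ ∀ w' ∈ Z, ‖y - w‖ ≤ ‖y - w'‖)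
    ⟨w, hw, fun w' hw' ↦ hmin.trans_le (ciInf_le hbdd ⟨w', hw'⟩)⟩
  exact ⟨hmem, (norm_eq_iInf_iff_real_inner_le_zero hc hmem).1
    (le_antisymm (le_ciInf fun w' ↦ hle w' w'.2) (ciInf_le hbdd ⟨_, hmem⟩))⟩

theorem proj_mem (hZ : IsComplete Z) (hc : Convex ℝ Z) (hne : Z.Nonempty) (y : E) :
    proj Z y ∈ Z :=
  (proj_mem_and_inner_le_zero hZ hc hne y).1

theorem norm_proj_sub_le (hZ : IsComplete Z) (hc : Convex ℝ Z) {w : E} (hw : w ∈ Z) (y : E) :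
    ‖proj Z y - w‖ ≤ ‖y - w‖ := by
  have hinner := (proj_mem_and_inner_le_zero hZ hc ⟨w, hw⟩ y).2 w hw
  set P := proj Z y
  have hsq : ‖y - w‖ ^ 2 = ‖y - P‖ ^ 2 - 2 * inner ℝ (y - P) (w - P) + ‖P - w‖ ^ 2 := by
    rw [← sub_sub_sub_cancel_right y w P, norm_sub_sq_real, norm_sub_rev w P]
  exact le_of_sq_le_sq (by linarith [sq_nonneg ‖y - P‖]) (norm_nonneg _)

/-- A projected step along an approximation `g` of the direction `G`. -/
theorem sq_norm_proj_sub_smul_sub_le (hZ : IsComplete Z) (hc : Convex ℝ Z) {v w g G : E}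
    {α δ D : ℝ} (hw : w ∈ Z) (hα : 0 ≤ α) (hg : ‖g - G‖ ≤ δ) (hD : ‖v - w‖ ≤ D) :
    ‖proj Z (v - α • g) - w‖ ^ 2 / 2 ≤ ‖v - w‖ ^ 2 / 2 - α * inner ℝ G (v - w) + α * (δ * D)
      + α ^ 2 * (‖G‖ ^ 2 + δ ^ 2) := by
  have hproj := pow_le_pow_left₀ (norm_nonneg _) (norm_proj_sub_le hZ hc hw (v - α • g)) 2
  have hexpand : ‖v - α • g - w‖ ^ 2
      = ‖v - w‖ ^ 2 - 2 * α * inner ℝ g (v - w) + α ^ 2 * ‖g‖ ^ 2 := by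
    rw [sub_right_comm, norm_sub_sq_real, inner_smul_right, norm_smul, mul_pow, Real.norm_eq_abs,
      sq_abs, real_inner_comm]
    ring
  have herr : inner ℝ G (v - w) - inner ℝ g (v - w) ≤ δ * D := by
    rw [← inner_sub_left]
    exact (real_inner_le_norm _ _).trans
      (mul_le_mul (norm_sub_rev G g ▸ hg) hD (norm_nonneg _) ((norm_nonneg _).trans hg))
  have hg_sq : ‖g‖ ^ 2 ≤ 2 * (‖G‖ ^ 2 + δ ^ 2) := by
    have hg_le : ‖g‖ ≤ ‖G‖ + δ := by linarith [norm_sub_norm_le g G]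
    exact (pow_le_pow_left₀ (norm_nonneg _) hg_le 2).trans add_sq_le
  linarith [mul_le_mul_of_nonneg_left herr hα, mul_le_mul_of_nonneg_left hg_sq (sq_nonneg α)]

end Projection

section Prox

variable {E : Type*} [NormedAddCommGroup E] [InnerProductSpace ℝ E] {G d : E}
  {lam δ : ℝ}

theorem inner_le_of_prox (hprox : ‖G + lam • d‖ ≤ lam / 2 * ‖d‖ + δ)
    (hlong : 4 * δ < lam * ‖d‖) :
    2 * (lam * inner ℝ G d) ≤ -‖G‖ ^ 2 - 7 / 16 * (lam * ‖d‖) ^ 2 := by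
  have hexpand : ‖G + lam • d‖ ^ 2 = ‖G‖ ^ 2 + 2 * (lam * inner ℝ G d) + (lam * ‖d‖) ^ 2 := by
    rw [norm_add_sq_real, inner_smul_right, norm_smul, mul_pow, mul_pow, Real.norm_eq_abs, sq_abs]
  have hsq : ‖G + lam • d‖ ^ 2 ≤ (3 / 4 * (lam * ‖d‖)) ^ 2 :=
    pow_le_pow_left₀ (norm_nonneg _) (by linarith) 2
  linarith

theorem norm_le_of_prox (hlam : 0 ≤ lam) (hprox : ‖G + lam • d‖ ≤ lam / 2 * ‖d‖ + δ)
    (hshort : lam * ‖d‖ ≤ 4 * δ) : ‖G‖ ≤ 7 * δ := by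
  have htriangle := norm_sub_le (G + lam • d) (lam • d)
  rw [add_sub_cancel_right, norm_smul, Real.norm_of_nonneg hlam] at htriangle
  linarith

/-- The progress of a long proximal step absorbs the quadratic error of the projected step of
length `θ * a` that follows it. -/
theorem mul_inner_add_le_of_prox {a B L θ : ℝ} (hδ : 0 ≤ δ) (hθ : 0 ≤ θ) (hB : 0 ≤ B)
    (hroot : B = 2 * L * a ^ 2) (hlam : θ * lam ≤ L)
    (hprox : ‖G + lam • d‖ ≤ lam / 2 * ‖d‖ + δ) (hlong : 4 * δ < lam * ‖d‖) :
    θ * (B * inner ℝ G d) + (θ * a) ^ 2 * (‖G‖ ^ 2 + δ ^ 2)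
      ≤ -(3 / 16 * (B * (θ * lam) * ‖d‖ ^ 2)) := by
  have hlam_pos : 0 < lam := pos_of_mul_pos_left (by linarith) (norm_nonneg d)
  have hδ_sq : δ ^ 2 ≤ (lam * ‖d‖) ^ 2 / 16 := by
    linarith [pow_le_pow_left₀ hδ (show δ ≤ lam * ‖d‖ / 4 by linarith) 2]
  have hstep : 2 * lam * (θ * a) ^ 2 ≤ θ * B := by
    rw [hroot]
    linarith [mul_le_mul_of_nonneg_left hlam (show 0 ≤ 2 * θ * a ^ 2 by positivity)]
  have hinner := mul_le_mul_of_nonneg_left (inner_le_of_prox hprox hlong) (mul_nonneg hθ hB)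
  have hquad : 2 * lam * (θ * a) ^ 2 * (‖G‖ ^ 2 + δ ^ 2)
      ≤ θ * B * (‖G‖ ^ 2 + (lam * ‖d‖) ^ 2 / 16) := by gcongr
  refine le_of_mul_le_mul_left ?_ (show 0 < 2 * lam by positivity)
  linarith

end Prox


/-! ### One iteration -/

namespace State

variable {E : Type*} {Z : Set E} {x : State E}

/-- The trial step `a'` taken from the state `x`. -/
noncomputable def trialStep (x : State E) : ℝ := stepRoot x.A x.lamP

/-- The invariants of the states reached within an epoch. -/
structure IsValid (Z : Set E) (x : State E) : Prop where
  z_mem : x.z ∈ Z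
  zt_mem : x.zt ∈ Z
  v_mem : x.v ∈ Z
  A_nonneg : 0 ≤ x.A
  lamP_pos : 0 < x.lamP

theorem IsValid.trialStep_pos (hx : x.IsValid Z) : 0 < x.trialStep :=
  ((stepRoot_iff hx.A_nonneg hx.lamP_pos _).2 rfl).1

theorem IsValid.A_add_trialStep (hx : x.IsValid Z) :
    x.A + x.trialStep = 2 * x.lamP * x.trialStep ^ 2 :=
  ((stepRoot_iff hx.A_nonneg hx.lamP_pos _).2 rfl).2

variable [NormedAddCommGroup E] [InnerProductSpace ℝ E] {p : ℕ} {γ δ : ℝ} {g iGrad : E → E}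
  {iProx : E → E × E}

/-- The centre `z̄` of the proximal step taken from the state `x`. -/
noncomputable def center (x : State E) : E :=
  (x.A / (x.A + x.trialStep)) • x.z + (x.trialStep / (x.A + x.trialStep)) • x.v

/-- The distance covered by the proximal step taken from the state `x`. -/
noncomputable def stepDist (iProx : E → E × E) (x : State E) : ℝ :=
  ‖(iProx x.center).1 - x.center‖

/-- The true proximal weight `λ` of the step taken from the state `x`, as opposed to its guess
`x.lamP`. -/
noncomputable def stepWeight (p : ℕ) (γ : ℝ) (iProx : E → E × E) (x : State E) : ℝ :=
  γ * x.stepDist iProx ^ (p - 1)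

/-- The factor `γ_{t+1}` (called `θ` in `step`) that shortens the trial step when the proximal
weight was underestimated. -/
noncomputable def damping (p : ℕ) (γ : ℝ) (iProx : E → E × E) (x : State E) : ℝ :=
  open Classical in
    if x.stepWeight p γ iProx ≤ x.lamP then 1 else x.lamP / x.stepWeight p γ iProx

/-- The `AIPE.movement` of the step taken from the state `x`. -/
noncomputable def movement (p : ℕ) (γ : ℝ) (iProx : E → E × E) (x : State E) : ℝ :=
  (x.A + x.trialStep) * min (x.stepWeight p γ iProx) x.lamP * x.stepDist iProx ^ 2

theorem IsValid.center_mem (hx : x.IsValid Z) (hc : Convex ℝ Z) : x.center ∈ Z := by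
  have ha := hx.trialStep_pos
  have hA := hx.A_nonneg
  exact hc hx.z_mem hx.v_mem (by positivity) (by positivity) (by field_simp)

theorem IsValid.add_smul_center (hx : x.IsValid Z) :
    (x.A + x.trialStep) • x.center = x.A • x.z + x.trialStep • x.v := by
  have ha := hx.trialStep_pos
  have hA := hx.A_nonneg
  rw [center, smul_add, smul_smul, smul_smul, mul_div_cancel₀ _ (by positivity),
    mul_div_cancel₀ _ (by positivity)]

theorem IsValid.damping_pos (hx : x.IsValid Z) : 0 < x.damping p γ iProx := by
  unfold damping
  split_ifs with hle
  · exact one_pos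
  · exact div_pos hx.lamP_pos (hx.lamP_pos.trans (not_le.1 hle))

theorem IsValid.damping_le_one (hx : x.IsValid Z) : x.damping p γ iProx ≤ 1 := by
  unfold damping
  split_ifs with hle
  · exact le_rfl
  · exact (div_le_one (hx.lamP_pos.trans (not_le.1 hle))).2 (not_le.1 hle).le

theorem IsValid.damping_mul_stepWeight (hx : x.IsValid Z) :
    x.damping p γ iProx * x.stepWeight p γ iProx = min (x.stepWeight p γ iProx) x.lamP := by
  unfold damping
  split_ifs with hle
  · rw [one_mul, min_eq_left hle]
  · rw [min_eq_right (not_le.1 hle).le, div_mul_cancel₀ _ (hx.lamP_pos.trans (not_le.1 hle)).ne']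

theorem step_A : (step p γ Z iGrad iProx x).A = x.A + x.damping p γ iProx * x.trialStep := by
  unfold damping
  congr

theorem step_z : (step p γ Z iGrad iProx x).z =
    ((1 - x.damping p γ iProx) * x.A / (x.A + x.damping p γ iProx * x.trialStep)) • x.z
      + (x.damping p γ iProx * (x.A + x.trialStep) / (x.A + x.damping p γ iProx * x.trialStep))
        • (iProx x.center).1 := rfl

theorem step_v : (step p γ Z iGrad iProx x).v = proj Z (x.v -
    (x.damping p γ iProx * x.trialStep) • (iGrad (iProx x.center).1 + (iProx x.center).2)) := rfl

theorem step_A_of_le (hle : x.stepWeight p γ iProx ≤ x.lamP) :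
    (step p γ Z iGrad iProx x).A = x.A + x.trialStep := by
  rw [step_A, damping, if_pos hle, one_mul]

theorem step_lamP_of_le (hle : x.stepWeight p γ iProx ≤ x.lamP) :
    (step p γ Z iGrad iProx x).lamP = x.lamP / 2 := if_pos hle

theorem step_lamP_of_lt (hlt : x.lamP < x.stepWeight p γ iProx) :
    (step p γ Z iGrad iProx x).lamP = 2 * x.lamP := if_neg hlt.not_ge

theorem IsValid.A_le_step_A (hx : x.IsValid Z) : x.A ≤ (step p γ Z iGrad iProx x).A := by
  rw [step_A]
  exact le_add_of_nonneg_right (mul_pos hx.damping_pos hx.trialStep_pos).le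

theorem IsValid.step (hx : x.IsValid Z) (hZ : IsComplete Z) (hc : Convex ℝ Z)
    (hprox : IsProxOracle p Z g δ γ iProx) : (step p γ Z iGrad iProx x).IsValid Z where
  z_mem := by
    have hθ := hx.damping_pos (p := p) (γ := γ) (iProx := iProx)
    have hθ' := sub_nonneg.2 (hx.damping_le_one (p := p) (γ := γ) (iProx := iProx))
    have ha := hx.trialStep_pos
    have hA := hx.A_nonneg
    rw [step_z]
    refine hc hx.z_mem (hprox _ (hx.center_mem hc)).1 (by positivity) (by positivity) ?_
    field_simp
    ring
  zt_mem := (hprox _ (hx.center_mem hc)).1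
  v_mem := proj_mem hZ hc ⟨_, hx.z_mem⟩ _
  A_nonneg := hx.A_nonneg.trans hx.A_le_step_A
  lamP_pos := by
    have hL := hx.lamP_pos
    rcases le_or_gt (x.stepWeight p γ iProx) x.lamP with hle | hlt
    · rw [step_lamP_of_le hle]; positivity
    · rw [step_lamP_of_lt hlt]; positivity

end State

section Step

variable {E : Type*} [NormedAddCommGroup E] [InnerProductSpace ℝ E] {p : ℕ} {γ δ μ : ℝ}
  {Z : Set E} {h : E → ℝ} {g iGrad : E → E} {iProx : E → E × E} {x : State E} {zstar : E}

theorem sub_le_of_short_step (hZ : Bornology.IsBounded Z) (hμ : 0 ≤ μ) (hγ : 0 ≤ γ) {q : ℕ}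
    (hh : UniformlyConvexOn q μ Z h g) (hprox : IsProxOracle p Z g δ γ iProx)
    (hstar : zstar ∈ Z) {zbar : E} (hzbar : zbar ∈ Z)
    (hshort : proxWeight p γ (iProx zbar).1 zbar * ‖(iProx zbar).1 - zbar‖ ≤ 4 * δ) :
    h (iProx zbar).1 - h zstar ≤ 7 * δ * Metric.diam Z := by
  obtain ⟨hzt, hu, hresidual⟩ := hprox zbar hzbar
  have hG := norm_le_of_prox (by unfold proxWeight; positivity) hresidual hshort
  calc h (iProx zbar).1 - h zstar
      ≤ inner ℝ (g (iProx zbar).1 + (iProx zbar).2) ((iProx zbar).1 - zstar) :=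
        hh.sub_le_inner_add hμ hzt hstar hu
    _ ≤ ‖g (iProx zbar).1 + (iProx zbar).2‖ * ‖(iProx zbar).1 - zstar‖ :=
        real_inner_le_norm _ _
    _ ≤ 7 * δ * Metric.diam Z :=
        mul_le_mul hG (dist_eq_norm (iProx zbar).1 zstar ▸ Metric.dist_le_diam_of_mem hZ hzt hstar)
          (norm_nonneg _) ((norm_nonneg _).trans hG)

/-- The new `z` averages the old one and the proximal point `zt`, so convexity bounds its value by
linear terms in the direction `g zt + u`; the centre `zbar` is chosen to combine them. -/
theorem UniformlyConvexOn.mul_combo_sub_le {q : ℕ} (hh : UniformlyConvexOn q μ Z h g) (hμ : 0 ≤ μ)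
    (hc : Convex ℝ Z) {A a θ : ℝ} (hA : 0 ≤ A) (ha : 0 < a) (hθ : 0 < θ) (hθ1 : θ ≤ 1)
    {z zt zbar v u : E} (hz : z ∈ Z) (hzt : zt ∈ Z) (hu : u ∈ normalCone Z zt)
    (hstar : zstar ∈ Z) (hbar : (A + a) • zbar = A • z + a • v) :
    (A + θ * a)
        * (h (((1 - θ) * A / (A + θ * a)) • z + (θ * (A + a) / (A + θ * a)) • zt) - h zstar)
      ≤ A * (h z - h zstar) + θ * ((A + a) * inner ℝ (g zt + u) (zt - zbar))
        + θ * a * inner ℝ (g zt + u) (v - zstar) := by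
  have hcombo : h (((1 - θ) * A / (A + θ * a)) • z + (θ * (A + a) / (A + θ * a)) • zt)
      ≤ (1 - θ) * A / (A + θ * a) * h z + θ * (A + a) / (A + θ * a) * h zt :=
    hh.map_combo_le hμ hc hz hzt (div_nonneg (mul_nonneg (sub_nonneg.2 hθ1) hA) (by positivity))
      (by positivity) (by field_simp; ring)
  have hcoupling : a * inner ℝ (g zt + u) (zt - zstar) + A * inner ℝ (g zt + u) (zt - z)
      = (A + a) * inner ℝ (g zt + u) (zt - zbar) + a * inner ℝ (g zt + u) (v - zstar) := by
    simp only [← inner_smul_right, ← inner_add_right]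
    rw [smul_sub (A + a), hbar]
    congr 1; module
  calc (A + θ * a)
        * (h (((1 - θ) * A / (A + θ * a)) • z + (θ * (A + a) / (A + θ * a)) • zt) - h zstar)
      ≤ (A + θ * a) * ((1 - θ) * A / (A + θ * a) * h z + θ * (A + a) / (A + θ * a) * h zt
          - h zstar) := by gcongr
    _ = A * (h z - h zstar) + θ * (a * (h zt - h zstar) + A * (h zt - h z)) := by field_simp; ring
    _ ≤ A * (h z - h zstar)
          + θ * (a * inner ℝ (g zt + u) (zt - zstar) + A * inner ℝ (g zt + u) (zt - z)) := by
        gcongr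
        exacts [hh.sub_le_inner_add hμ hzt hstar hu, hh.sub_le_inner_add hμ hzt hz hu]
    _ = _ := by rw [hcoupling]; ring

/-- The Lyapunov function of the accelerated method. -/
noncomputable def lyapunov (h : E → ℝ) (zstar : E) (x : State E) : ℝ :=
  x.A * (h x.z - h zstar) + ‖x.v - zstar‖ ^ 2 / 2

theorem lyapunov_step_le {q : ℕ} (hZ : IsComplete Z) (hb : Bornology.IsBounded Z)
    (hc : Convex ℝ Z) (hμ : 0 ≤ μ) (hδ : 0 ≤ δ) (hh : UniformlyConvexOn q μ Z h g)
    (hgrad : IsFirstOrderOracle Z g δ iGrad) (hprox : IsProxOracle p Z g δ γ iProx)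
    (hstar : zstar ∈ Z) (hx : x.IsValid Z)
    (hlong : 4 * δ < x.stepWeight p γ iProx * x.stepDist iProx) :
    lyapunov h zstar (step p γ Z iGrad iProx x) ≤ lyapunov h zstar x
      + ((step p γ Z iGrad iProx x).A - x.A) * (δ * Metric.diam Z)
      - 3 / 16 * x.movement p γ iProx := by
  obtain ⟨hzt, hu, hresidual⟩ := hprox _ (hx.center_mem hc)
  have hθ := hx.damping_pos (p := p) (γ := γ) (iProx := iProx)
  have ha := hx.trialStep_pos
  have hvalue := hh.mul_combo_sub_le hμ hc hx.A_nonneg ha hθ hx.damping_le_one hx.z_mem hzt hu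
    hstar hx.add_smul_center
  have hdirection : ‖iGrad (iProx x.center).1 + (iProx x.center).2
      - (g (iProx x.center).1 + (iProx x.center).2)‖ ≤ δ := by
    rw [add_sub_add_right_eq_sub]
    exact hgrad _ hzt
  have hdiam : ‖x.v - zstar‖ ≤ Metric.diam Z :=
    dist_eq_norm x.v zstar ▸ Metric.dist_le_diam_of_mem hb hx.v_mem hstar
  have hmirror := sq_norm_proj_sub_smul_sub_le hZ hc hstar (mul_pos hθ ha).le hdirection hdiam
  have hprogress := mul_inner_add_le_of_prox hδ hθ.le (add_nonneg hx.A_nonneg ha.le)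
    hx.A_add_trialStep (hx.damping_mul_stepWeight.trans_le (min_le_right _ _)) hresidual hlong
  rw [State.movement, ← hx.damping_mul_stepWeight, lyapunov, lyapunov, State.step_z, State.step_v,
    State.step_A]
  rw [State.stepDist] at *
  linarith

end Step


/-! ### Rates and the number of epochs -/

theorem rate_pos (p : ℕ) {γ μ : ℝ} (hγ : 0 < γ) (hμ : 0 < μ) : 0 < rate p γ μ :=
  Real.rpow_pos_of_pos (div_pos hγ hμ) _

theorem rate_pow (p : ℕ) {γ μ : ℝ} (hγ : 0 ≤ γ) (hμ : 0 ≤ μ) :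
    rate p γ μ ^ (3 * p + 1) = (γ / μ) ^ 2 := by
  rw [rate, ← Real.rpow_natCast, ← Real.rpow_mul (by positivity), ← Real.rpow_natCast (γ / μ)]
  congr 1; push_cast; field_simp

/-- The constant `C₁` for which epochs of length `⌈C₁ * rate p γ μ⌉` halve the optimality gap. -/
noncomputable def epochConst (p : ℕ) : ℝ :=
  (growthConst p * (3 ^ (p - 1) * (4 * (p + 1))) ^ 2) ^ (((3 * p + 1 : ℕ) : ℝ)⁻¹)

theorem epochConst_pos (p : ℕ) : 0 < epochConst p := by
  have := growthConst_pos p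
  unfold epochConst
  positivity

theorem epochConst_mul_rate_pow (p : ℕ) {γ μ : ℝ} (hγ : 0 ≤ γ) (hμ : 0 ≤ μ) :
    (epochConst p * rate p γ μ) ^ (3 * p + 1)
      = growthConst p * (3 ^ (p - 1) * (4 * (p + 1)) * (γ / μ)) ^ 2 := by
  have := growthConst_pos p
  rw [mul_pow, rate_pow p hγ hμ, epochConst,
    Real.rpow_inv_natCast_pow (by positivity) (Nat.succ_ne_zero _)]
  ring

/-! ### One epoch -/

section Epoch

variable {E : Type*} [NormedAddCommGroup E] [InnerProductSpace ℝ E] {p T : ℕ} {γ δ μ ε : ℝ}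
  {Z : Set E} {h iFunc : E → ℝ} {g iGrad : E → E} {iProx : E → E × E} {z0 z1 zstar : E}

theorem epochState_succ (p : ℕ) (γ : ℝ) (Z : Set E) (iGrad : E → E) (iProx : E → E × E) (z0 : E)
    (t : ℕ) : epochState p γ Z iGrad iProx z0 (t + 1)
      = step p γ Z iGrad iProx (epochState p γ Z iGrad iProx z0 t) :=
  Function.iterate_succ_apply' _ _ _

theorem isValid_epochState (hZ : IsComplete Z) (hc : Convex ℝ Z) (hγ : 0 ≤ γ)
    (hprox : IsProxOracle p Z g δ γ iProx) (hz0 : z0 ∈ Z) (hne : (init p γ iProx z0).lamP ≠ 0)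
    (t : ℕ) : (epochState p γ Z iGrad iProx z0 t).IsValid Z := by
  induction t with
  | zero =>
    have hlam : 0 ≤ (init p γ iProx z0).lamP := mul_nonneg hγ (pow_nonneg (norm_nonneg _) _)
    exact ⟨hz0, hz0, hz0, le_rfl, hlam.lt_of_ne' hne⟩
  | succ t ih => rw [epochState_succ]; exact ih.step hZ hc hprox

theorem center_init (hx : (init p γ iProx z0).IsValid Z) : (init p γ iProx z0).center = z0 := by
  have ha := hx.trialStep_pos
  have hcenter := hx.add_smul_center
  simp only [init, zero_add, zero_smul] at ha hcenter ⊢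
  exact smul_right_injective E ha.ne' hcenter

theorem isSearchFreeSeq_epochState (hvalid : ∀ t, (epochState p γ Z iGrad iProx z0 t).IsValid Z)
    (hmoves : ∀ t < T, 0 < (epochState p γ Z iGrad iProx z0 t).stepDist iProx) :
    IsSearchFreeSeq p γ T (fun t ↦ (epochState p γ Z iGrad iProx z0 t).A)
      (fun t ↦ (epochState p γ Z iGrad iProx z0 t).lamP)
      (fun t ↦ (epochState p γ Z iGrad iProx z0 t).trialStep)
      (fun t ↦ (epochState p γ Z iGrad iProx z0 t).stepDist iProx) where
  A_zero := rfl
  L_zero := by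
    change γ * ‖(iProx z0).1 - z0‖ ^ (p - 1) = (init p γ iProx z0).stepWeight p γ iProx
    rw [State.stepWeight, State.stepDist, center_init (hvalid 0)]
  a_pos t _ := (hvalid t).trialStep_pos
  r_pos := hmoves
  root t _ := (hvalid t).A_add_trialStep
  down t _ hle := by
    simp only [epochState_succ]
    exact ⟨State.step_A_of_le hle, State.step_lamP_of_le hle⟩
  up t _ hlt := by
    simp only [epochState_succ]
    exact ⟨(hvalid t).A_le_step_A, State.step_lamP_of_lt hlt⟩

theorem lyapunov_epochState_le {q : ℕ} (hZ : IsComplete Z) (hb : Bornology.IsBounded Z)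
    (hc : Convex ℝ Z) (hμ : 0 ≤ μ) (hδ : 0 ≤ δ) (hh : UniformlyConvexOn q μ Z h g)
    (hgrad : IsFirstOrderOracle Z g δ iGrad) (hprox : IsProxOracle p Z g δ γ iProx)
    (hstar : zstar ∈ Z) (hvalid : ∀ t, (epochState p γ Z iGrad iProx z0 t).IsValid Z)
    (hlong : ∀ t < T, 4 * δ < (epochState p γ Z iGrad iProx z0 t).stepWeight p γ iProx
      * (epochState p γ Z iGrad iProx z0 t).stepDist iProx) :
    lyapunov h zstar (epochState p γ Z iGrad iProx z0 T) ≤ ‖z0 - zstar‖ ^ 2 / 2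
      + (epochState p γ Z iGrad iProx z0 T).A * (δ * Metric.diam Z)
      - 3 / 16 * ∑ t ∈ Finset.range T, (epochState p γ Z iGrad iProx z0 t).movement p γ iProx := by
  induction T with
  | zero => simp [lyapunov, epochState, init]
  | succ T ih =>
    have hstep := lyapunov_step_le hZ hb hc hμ hδ hh hgrad hprox hstar (hvalid T)
      (hlong T (Nat.lt_succ_self T))
    rw [← epochState_succ] at hstep
    rw [Finset.sum_range_succ]
    linarith [ih fun t ht ↦ hlong t (Nat.lt_succ_of_lt ht)]

theorem UniformlyConvexOn.mul_pow_lt_of_mul_sub_lt (hh : UniformlyConvexOn (p + 1) μ Z h g)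
    (hp : 1 ≤ p) (hc : Convex ℝ Z) (hμ : 0 < μ) (hγ : 0 < γ) (hz0 : z0 ∈ Z) (hstar : zstar ∈ Z)
    (hmin : IsMinOn h Z zstar) {A : ℝ} (hA : 0 ≤ A)
    (hlt : A * (h z0 - h zstar) < 4 * ‖z0 - zstar‖ ^ 2) :
    A * γ * (3 * ‖z0 - zstar‖) ^ (p - 1) < 3 ^ (p - 1) * (4 * (p + 1)) * (γ / μ) := by
  have hgap := hh.norm_pow_le hμ.le hc hstar hz0 hmin
  set R := ‖z0 - zstar‖
  have hsplit : R ^ (p + 1) = R ^ (p - 1) * R ^ 2 := by rw [← pow_add]; congr 1; omega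
  have hlt' : A * R ^ (p - 1) * (μ / (p + 1)) * R ^ 2 < 4 * R ^ 2 := by
    calc A * R ^ (p - 1) * (μ / (p + 1)) * R ^ 2 = A * (μ / (p + 1 : ℕ) * R ^ (p + 1)) := by
          rw [hsplit]; push_cast; ring
      _ ≤ A * (h z0 - h zstar) := by gcongr
      _ < _ := hlt
  have hAR : A * R ^ (p - 1) < 4 * (p + 1) / μ := by
    have := lt_of_mul_lt_mul_right hlt' (sq_nonneg R)
    rw [mul_div_assoc', div_lt_iff₀ (by positivity)] at this
    rwa [lt_div_iff₀ hμ]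
  calc A * γ * (3 * R) ^ (p - 1) = 3 ^ (p - 1) * γ * (A * R ^ (p - 1)) := by rw [mul_pow]; ring
    _ < 3 ^ (p - 1) * γ * (4 * (p + 1) / μ) := by gcongr
    _ = _ := by ring

/-- If `A` were small, the Lyapunov function would bound the total movement; the growth of
search-free sequences would then make `A` large after all. -/
theorem four_mul_sq_norm_le (hp : 1 ≤ p) (hc : Convex ℝ Z) (hμ : 0 < μ) (hγ : 0 < γ)
    (hh : UniformlyConvexOn (p + 1) μ Z h g) (hz0 : z0 ∈ Z) (hstar : zstar ∈ Z)
    (hmin : IsMinOn h Z zstar) (hT : epochConst p * rate p γ μ ≤ T) (hne : z0 ≠ zstar)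
    (hsmall : δ * Metric.diam Z ≤ (h z0 - h zstar) / 8)
    (hvalid : ∀ t, (epochState p γ Z iGrad iProx z0 t).IsValid Z)
    (hmoves : ∀ t < T, 0 < (epochState p γ Z iGrad iProx z0 t).stepDist iProx)
    (hlyap : lyapunov h zstar (epochState p γ Z iGrad iProx z0 T) ≤ ‖z0 - zstar‖ ^ 2 / 2
      + (epochState p γ Z iGrad iProx z0 T).A * (δ * Metric.diam Z)
      - 3 / 16 * ∑ t ∈ Finset.range T, (epochState p γ Z iGrad iProx z0 t).movement p γ iProx) :
    4 * ‖z0 - zstar‖ ^ 2 ≤ (epochState p γ Z iGrad iProx z0 T).A * (h z0 - h zstar) := by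
  by_contra! hlt
  have hA := (hvalid T).A_nonneg
  have hR : 0 < ‖z0 - zstar‖ := norm_pos_iff.2 (sub_ne_zero.2 hne)
  have hT0 : 0 < epochConst p * rate p γ μ := mul_pos (epochConst_pos p) (rate_pos p hγ hμ)
  have hmovement : ∑ t ∈ Finset.range T, (epochState p γ Z iGrad iProx z0 t).movement p γ iProx
      ≤ (3 * ‖z0 - zstar‖) ^ 2 := by
    have hvalue := mul_nonneg hA (sub_nonneg.2 (hmin (hvalid T).z_mem))
    have herror := mul_le_mul_of_nonneg_left hsmall hA
    rw [lyapunov] at hlyap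
    linarith [sq_nonneg ‖(epochState p γ Z iGrad iProx z0 T).v - zstar‖, sq_nonneg ‖z0 - zstar‖]
  have hgrowth := (isSearchFreeSeq_epochState hvalid hmoves).pow_le hp hγ
    (by exact_mod_cast hT0.trans_le hT) (by positivity) hmovement
  have hupper := hh.mul_pow_lt_of_mul_sub_lt hp hc hμ hγ hz0 hstar hmin hA hlt
  refine lt_irrefl ((T : ℝ) ^ (3 * p + 1)) ?_
  calc (T : ℝ) ^ (3 * p + 1)
      ≤ growthConst p * ((epochState p γ Z iGrad iProx z0 T).A * γ
          * (3 * ‖z0 - zstar‖) ^ (p - 1)) ^ 2 := hgrowth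
    _ < growthConst p * (3 ^ (p - 1) * (4 * (p + 1)) * (γ / μ)) ^ 2 := by
        have := growthConst_pos p
        gcongr
    _ = (epochConst p * rate p γ μ) ^ (3 * p + 1) := (epochConst_mul_rate_pow p hγ.le hμ.le).symm
    _ ≤ (T : ℝ) ^ (3 * p + 1) := by gcongr

/-- An epoch comes close to the minimum through one of the points `z̃` if some proximal step is
dominated by the oracle error, and through its last `z` otherwise. -/
theorem exists_near_min (hp : 1 ≤ p) (hZ : IsComplete Z) (hb : Bornology.IsBounded Z)
    (hc : Convex ℝ Z) (hμ : 0 < μ) (hγ : 0 < γ) (hδ : 0 ≤ δ)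
    (hh : UniformlyConvexOn (p + 1) μ Z h g) (hgrad : IsFirstOrderOracle Z g δ iGrad)
    (hprox : IsProxOracle p Z g δ γ iProx) (hz0 : z0 ∈ Z) (hstar : zstar ∈ Z)
    (hmin : IsMinOn h Z zstar) (hne : (init p γ iProx z0).lamP ≠ 0)
    (hT : epochConst p * rate p γ μ ≤ T) (hpos : 0 < h z0 - h zstar)
    (hsmall : δ * Metric.diam Z ≤ (h z0 - h zstar) / 8) :
    (∃ t ≤ T, h (epochState p γ Z iGrad iProx z0 t).zt - h zstar ≤ 7 * δ * Metric.diam Z) ∨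
      h (epochState p γ Z iGrad iProx z0 T).z - h zstar
        ≤ (h z0 - h zstar) / 8 + δ * Metric.diam Z := by
  have hvalid : ∀ t, (epochState p γ Z iGrad iProx z0 t).IsValid Z :=
    isValid_epochState hZ hc hγ.le hprox hz0 hne
  refine or_iff_not_imp_left.2 fun hfar ↦ ?_
  have hlong : ∀ t < T, 4 * δ < (epochState p γ Z iGrad iProx z0 t).stepWeight p γ iProx
      * (epochState p γ Z iGrad iProx z0 t).stepDist iProx := by
    refine fun t ht ↦ lt_of_not_ge fun hshort ↦ hfar ⟨t + 1, ht, ?_⟩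
    rw [epochState_succ]
    exact sub_le_of_short_step hb hμ.le hγ.le hh hprox hstar ((hvalid t).center_mem hc) hshort
  have hmoves : ∀ t < T, 0 < (epochState p γ Z iGrad iProx z0 t).stepDist iProx := fun t ht ↦
    (norm_nonneg _).lt_of_ne' fun h0 ↦ by
      have := hlong t ht
      rw [State.stepDist, h0, mul_zero] at this
      linarith
  have hlyap := lyapunov_epochState_le hZ hb hc hμ.le hδ hh hgrad hprox hstar hvalid hlong
  have hne_star : z0 ≠ zstar := by rintro rfl; simp at hpos
  have hbig := four_mul_sq_norm_le hp hc hμ hγ hh hz0 hstar hmin hT hne_star hsmall hvalid hmoves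
    hlyap
  have hgain : 0 ≤ ∑ t ∈ Finset.range T, (epochState p γ Z iGrad iProx z0 t).movement p γ iProx :=
    Finset.sum_nonneg fun t ht ↦
      ((isSearchFreeSeq_epochState hvalid hmoves).movement_pos hγ (Finset.mem_range.1 ht)).le
  have hR : 0 < ‖z0 - zstar‖ := norm_pos_iff.2 (sub_ne_zero.2 hne_star)
  have hA : 0 < (epochState p γ Z iGrad iProx z0 T).A :=
    pos_of_mul_pos_left (lt_of_lt_of_le (by positivity) hbig) hpos.le
  refine le_of_mul_le_mul_left ?_ hA
  rw [lyapunov] at hlyap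
  linarith [sq_nonneg ‖(epochState p γ Z iGrad iProx z0 T).v - zstar‖]

theorem candidates_subset (hZ : IsComplete Z) (hc : Convex ℝ Z) (hγ : 0 ≤ γ)
    (hprox : IsProxOracle p Z g δ γ iProx) (hz0 : z0 ∈ Z) :
    candidates p γ Z iGrad iProx T z0 ⊆ Z := by
  rintro w ⟨t, ht, hw⟩
  by_cases hne : (init p γ iProx z0).lamP = 0
  · rw [epochLength, if_pos hne] at ht
    obtain rfl : t = 0 := Nat.le_zero.1 ht
    rcases hw with rfl | rfl <;> exact hz0
  · have hvalid := isValid_epochState (iGrad := iGrad) hZ hc hγ hprox hz0 hne t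
    rcases hw with rfl | rfl
    exacts [hvalid.z_mem, hvalid.zt_mem]

theorem self_mem_candidates (p : ℕ) (γ : ℝ) (Z : Set E) (iGrad : E → E) (iProx : E → E × E)
    (T : ℕ) (z0 : E) : z0 ∈ candidates p γ Z iGrad iProx T z0 :=
  ⟨0, Nat.zero_le _, Or.inl rfl⟩

theorem IsEpochOutput.le_add (hout : IsEpochOutput p γ Z iFunc iGrad iProx T z0 z1)
    (hZ : IsComplete Z) (hc : Convex ℝ Z) (hγ : 0 ≤ γ) (hprox : IsProxOracle p Z g δ γ iProx)
    (hfunc : IsZerothOrderOracle Z h δ iFunc) (hz0 : z0 ∈ Z) {w : E}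
    (hw : w ∈ candidates p γ Z iGrad iProx T z0) : h z1 ≤ h w + 2 * δ := by
  have hsubset := candidates_subset (T := T) (iGrad := iGrad) hZ hc hγ hprox hz0
  linarith [neg_le_of_abs_le (hfunc z1 (hsubset hout.1)), le_of_abs_le (hfunc w (hsubset hw)),
    hout.2 w hw]

/-- An epoch that is broken off at once starts at a point the proximal oracle cannot move, which
is nearly optimal. -/
theorem sub_le_of_init_lamP_eq_zero {q : ℕ} (hb : Bornology.IsBounded Z) (hμ : 0 ≤ μ) (hγ : 0 < γ)
    (hδ : 0 ≤ δ) (hh : UniformlyConvexOn q μ Z h g) (hprox : IsProxOracle p Z g δ γ iProx)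
    (hz0 : z0 ∈ Z) (hstar : zstar ∈ Z) (hzero : (init p γ iProx z0).lamP = 0) :
    h z0 - h zstar ≤ 7 * δ * Metric.diam Z := by
  have hfixed : (iProx z0).1 = z0 := by
    have hpow : ‖(iProx z0).1 - z0‖ ^ (p - 1) = 0 := (mul_eq_zero.1 hzero).resolve_left hγ.ne'
    exact sub_eq_zero.1 (norm_eq_zero.1 (eq_zero_of_pow_eq_zero hpow))
  have hshort := sub_le_of_short_step hb hμ hγ.le hh hprox hstar hz0
    (by rw [hfixed, sub_self, norm_zero, mul_zero]; positivity)
  rwa [hfixed] at hshort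

theorem IsEpochOutput.sub_le_max (hout : IsEpochOutput p γ Z iFunc iGrad iProx T z0 z1)
    (hp : 1 ≤ p) (hZ : IsComplete Z) (hb : Bornology.IsBounded Z) (hc : Convex ℝ Z) (hμ : 0 < μ)
    (hγ : 0 < γ) (hε : 0 < ε) (hδ : 0 ≤ δ) (hh : UniformlyConvexOn (p + 1) μ Z h g)
    (hfunc : IsZerothOrderOracle Z h δ iFunc) (hgrad : IsFirstOrderOracle Z g δ iGrad)
    (hprox : IsProxOracle p Z g δ γ iProx) (hz0 : z0 ∈ Z) (hstar : zstar ∈ Z)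
    (hmin : IsMinOn h Z zstar) (hT : epochConst p * rate p γ μ ≤ T)
    (herror : δ * max (Metric.diam Z) 1 ≤ ε / 16) :
    h z1 - h zstar ≤ max ((h z0 - h zstar) / 2) (5 / 8 * ε) := by
  have hδε : δ ≤ ε / 16 := (le_mul_of_one_le_right hδ (le_max_right _ _)).trans herror
  have hδD : δ * Metric.diam Z ≤ ε / 16 :=
    (mul_le_mul_of_nonneg_left (le_max_left _ _) hδ).trans herror
  rcases lt_or_ge (h z0 - h zstar) (ε / 2) with hnear | hfar
  · have := hout.le_add hZ hc hγ.le hprox hfunc hz0 (self_mem_candidates p γ Z iGrad iProx T z0)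
    exact le_max_of_le_right (by linarith)
  have hne : (init p γ iProx z0).lamP ≠ 0 := fun hzero ↦ by
    linarith [sub_le_of_init_lamP_eq_zero hb hμ.le hγ hδ hh hprox hz0 hstar hzero]
  have hlen : T ≤ epochLength p γ iProx T z0 := by rw [epochLength, if_neg hne]
  rcases exists_near_min hp hZ hb hc hμ hγ hδ hh hgrad hprox hz0 hstar hmin hne hT
    (by linarith) (by linarith) with ⟨t, ht, hvalue⟩ | hvalue
  · have := hout.le_add hZ hc hγ.le hprox hfunc hz0 ⟨t, ht.trans hlen, Or.inr rfl⟩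
    exact le_max_of_le_right (by linarith)
  · have := hout.le_add hZ hc hγ.le hprox hfunc hz0 ⟨T, hlen, Or.inl rfl⟩
    exact le_max_of_le_left (by linarith)

end Epoch


/-! ### Runs -/

section Run

variable {Δ ε δ : ℝ}

theorem div_two_pow_numEpochs_le (hΔ : 0 < Δ) (hε : 0 < ε) : Δ / 2 ^ numEpochs Δ ε ≤ ε := by
  have hceil : Real.logb 2 (Δ / ε) ≤ numEpochs Δ ε := Nat.le_ceil _
  rw [Real.logb_le_iff_le_rpow one_lt_two (by positivity), Real.rpow_natCast,
    div_le_iff₀ hε] at hceil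
  rwa [div_le_iff₀' (by positivity)]

theorem numEpochs_eq_zero (hΔ : 0 ≤ Δ) (hle : Δ ≤ ε) : numEpochs Δ ε = 0 :=
  Nat.ceil_eq_zero.2 (Real.logb_nonpos one_lt_two (div_nonneg hΔ (hΔ.trans hle))
    (div_le_one_of_le₀ hle (hΔ.trans hle)))

theorem numEpochs_le (Δ ε : ℝ) : (numEpochs Δ ε : ℝ) ≤ 2 * max 1 (Real.logb 2 (Δ / ε)) := by
  have hceil : (numEpochs Δ ε : ℝ) ≤ ⌈max 1 (Real.logb 2 (Δ / ε))⌉₊ :=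
    mod_cast Nat.ceil_mono (le_max_right _ _)
  have hone : (1 : ℝ) ≤ max 1 (Real.logb 2 (Δ / ε)) := le_max_left _ _
  linarith [Nat.ceil_lt_add_one (zero_le_one.trans hone)]

theorem natCeil_mul_le {c x : ℝ} (hc : 0 ≤ c) (hx : 0 ≤ x) :
    (⌈c * x⌉₊ : ℝ) ≤ (c + 1) * max 1 x := by
  have hceil := Nat.ceil_lt_add_one (mul_nonneg hc hx)
  have hmax : c * x ≤ c * max 1 x := by gcongr; exact le_max_right _ _
  linarith [le_max_left 1 x]

theorem mul_max_le_of_le_errorThreshold {p : ℕ} {μ D : ℝ} (hε : 0 < ε) (hΔ : ε < Δ) (hδ : 0 ≤ δ)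
    (hle : δ ≤ errorThreshold p μ D Δ ε) : δ * max D 1 ≤ ε / 16 := by
  have hΔ0 : 0 < Δ := hε.trans hΔ
  have hthreshold : δ ≤ ε ^ 2 / (2 ^ 4 * max D 1 * Δ) := hle.trans (min_le_right _ _)
  rw [le_div_iff₀ (mul_pos (by positivity) hΔ0)] at hthreshold
  refine le_of_mul_le_mul_right ?_ hε
  calc δ * max D 1 * ε ≤ δ * max D 1 * Δ := by gcongr
    _ ≤ ε / 16 * ε := by linarith

variable {E : Type*} [NormedAddCommGroup E] [InnerProductSpace ℝ E] {p T S : ℕ} {γ μ : ℝ}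
  {Z : Set E} {h iFunc : E → ℝ} {g iGrad : E → E} {iProx : E → E × E} {z0 zstar : E} {zs : ℕ → E}

theorem IsRun.mem_and_sub_le_max (hrun : IsRun p γ Z iFunc iGrad iProx T S z0 zs) (hp : 1 ≤ p)
    (hZ : IsComplete Z) (hb : Bornology.IsBounded Z) (hc : Convex ℝ Z) (hμ : 0 < μ) (hγ : 0 < γ)
    (hε : 0 < ε) (hδ : 0 ≤ δ) (hh : UniformlyConvexOn (p + 1) μ Z h g)
    (hfunc : IsZerothOrderOracle Z h δ iFunc) (hgrad : IsFirstOrderOracle Z g δ iGrad)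
    (hprox : IsProxOracle p Z g δ γ iProx) (hz0 : z0 ∈ Z) (hstar : zstar ∈ Z)
    (hmin : IsMinOn h Z zstar) (hT : epochConst p * rate p γ μ ≤ T)
    (herror : δ * max (Metric.diam Z) 1 ≤ ε / 16) {s : ℕ} (hs : s ≤ S) :
    zs s ∈ Z ∧ h (zs s) - h zstar ≤ max ((h z0 - h zstar) / 2 ^ s) (5 / 8 * ε) := by
  induction s with
  | zero => simp [hrun.1, hz0]
  | succ s ih =>
    obtain ⟨hmem, hvalue⟩ := ih (Nat.le_of_succ_le hs)
    have hout := hrun.2 s hs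
    refine ⟨candidates_subset hZ hc hγ.le hprox hmem hout.1, ?_⟩
    refine (hout.sub_le_max hp hZ hb hc hμ hγ hε hδ hh hfunc hgrad hprox hmem hstar hmin hT
      herror).trans (max_le ?_ (le_max_right _ _))
    rw [pow_succ, ← div_div]
    rcases le_max_iff.1 hvalue with hhalved | haccurate
    · exact le_max_of_le_left (by gcongr)
    · exact le_max_of_le_right (by linarith)

theorem IsRun.mem_and_sub_le (hrun : IsRun p γ Z iFunc iGrad iProx T S z0 zs) (hp : 1 ≤ p)
    (hZ : IsComplete Z) (hb : Bornology.IsBounded Z) (hc : Convex ℝ Z) (hμ : 0 < μ) (hγ : 0 < γ)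
    (hε : 0 < ε) (hh : UniformlyConvexOn (p + 1) μ Z h g)
    (hfunc : IsZerothOrderOracle Z h δ iFunc) (hgrad : IsFirstOrderOracle Z g δ iGrad)
    (hprox : IsProxOracle p Z g δ γ iProx) (hz0 : z0 ∈ Z) (hstar : zstar ∈ Z)
    (hmin : IsMinOn h Z zstar)
    (herror : ε < h z0 - h zstar → δ * max (Metric.diam Z) 1 ≤ ε / 16)
    (hT : epochConst p * rate p γ μ ≤ T) (hS : S = numEpochs (h z0 - h zstar) ε) :
    zs S ∈ Z ∧ h (zs S) - h zstar ≤ ε := by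
  rcases le_or_gt (h z0 - h zstar) ε with hle | hlt
  · rw [hS, numEpochs_eq_zero (sub_nonneg.2 (hmin hz0)) hle, hrun.1]
    exact ⟨hz0, hle⟩
  · have hδ : 0 ≤ δ := (abs_nonneg _).trans (hfunc z0 hz0)
    obtain ⟨hmem, hvalue⟩ := hrun.mem_and_sub_le_max hp hZ hb hc hμ hγ hε hδ hh hfunc hgrad hprox
      hz0 hstar hmin hT (herror hlt) le_rfl
    refine ⟨hmem, hvalue.trans (max_le ?_ (by linarith))⟩
    exact hS ▸ div_two_pow_numEpochs_le (hε.trans hlt) hε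

end Run

end AIPE

theorem mainTheorem4_general.{u} (p : ℕ) (hp : 1 ≤ p) :
    ∃ C₁ > (0 : ℝ), ∃ C₂ > (0 : ℝ),
      ∀ (E : Type u) [NormedAddCommGroup E] [InnerProductSpace ℝ E] (Z : Set E) (h : E → ℝ)
        (subgrad : E → E) (iFunc : E → ℝ) (iGrad : E → E) (iProx : E → E × E) (z0 zstar : E)
        (μ γ δ ε Δ : ℝ) (T S : ℕ),
        0 < μ → 0 < γ → 0 < ε →
        IsComplete Z → Bornology.IsBounded Z → Convex ℝ Z →
        AIPE.UniformlyConvexOn (p + 1) μ Z h subgrad →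
        AIPE.IsZerothOrderOracle Z h δ iFunc →
        AIPE.IsFirstOrderOracle Z subgrad δ iGrad →
        AIPE.IsProxOracle p Z subgrad δ γ iProx →
        z0 ∈ Z → zstar ∈ Z → IsMinOn h Z zstar →
        Δ = h z0 - h zstar →
        (ε < Δ → δ * max (Metric.diam Z) 1 ≤ ε / 16) →
        T = ⌈C₁ * AIPE.rate p γ μ⌉₊ →
        S = AIPE.numEpochs Δ ε →
        (T : ℝ) ≤ C₂ * max 1 (AIPE.rate p γ μ) ∧
        (T : ℝ) * S ≤ C₂ * (max 1 (AIPE.rate p γ μ) * max 1 (Real.logb 2 (Δ / ε))) ∧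
        ∀ zs : ℕ → E, AIPE.IsRun p γ Z iFunc iGrad iProx T S z0 zs →
          zs S ∈ Z ∧ h (zs S) - h zstar ≤ ε := by
  have hC := AIPE.epochConst_pos p
  refine ⟨AIPE.epochConst p, hC, 2 * (AIPE.epochConst p + 1), by positivity, ?_⟩
  rintro E _ _ Z h subgrad iFunc iGrad iProx z0 zstar μ γ δ ε _ T S hμ hγ hε hZ hb hc hh hfunc
    hgrad hprox hz0 hstar hmin rfl herror rfl hS
  have hrate := AIPE.rate_pos p hγ hμ
  have hT := AIPE.natCeil_mul_le hC.le hrate.le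
  refine ⟨hT.trans (by gcongr; linarith), ?_, fun zs hrun ↦
    hrun.mem_and_sub_le hp hZ hb hc hμ hγ hε hh hfunc hgrad hprox hz0 hstar hmin herror
      (Nat.le_ceil _) hS⟩
  calc (⌈AIPE.epochConst p * AIPE.rate p γ μ⌉₊ : ℝ) * S
      ≤ (AIPE.epochConst p + 1) * max 1 (AIPE.rate p γ μ)
          * (2 * max 1 (Real.logb 2 ((h z0 - h zstar) / ε))) := by
        gcongr
        exact hS ▸ AIPE.numEpochs_le _ ε
    _ = _ := by ring

theorem mainTheorem4 (p : ℕ) (hp : 1 ≤ p) :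
    ∃ C₁ > (0 : ℝ), ∃ C₂ > (0 : ℝ),
      ∀ (d : ℕ) (Z : Set (EuclideanSpace ℝ (Fin d)))
        (h : EuclideanSpace ℝ (Fin d) → ℝ)
        (grad : EuclideanSpace ℝ (Fin d) → EuclideanSpace ℝ (Fin d))
        (iFunc : EuclideanSpace ℝ (Fin d) → ℝ)
        (iGrad : EuclideanSpace ℝ (Fin d) → EuclideanSpace ℝ (Fin d))
        (iProx : EuclideanSpace ℝ (Fin d) → EuclideanSpace ℝ (Fin d) × EuclideanSpace ℝ (Fin d))
        (z0 zstar : EuclideanSpace ℝ (Fin d)) (μ γ δ ε Δ : ℝ) (T S : ℕ),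
        0 < μ → 0 < γ → 0 < ε →
        IsCompact Z → Convex ℝ Z →
        (∀ z ∈ Z, HasGradientWithinAt h (grad z) Z z) →
        AIPE.UniformlyConvexOn (p + 1) μ Z h grad →
        AIPE.IsZerothOrderOracle Z h δ iFunc →
        AIPE.IsFirstOrderOracle Z grad δ iGrad →
        AIPE.IsProxOracle p Z grad δ γ iProx →
        z0 ∈ Z → zstar ∈ Z → IsMinOn h Z zstar →
        Δ = h z0 - h zstar →
        (0 < Δ → δ ≤ AIPE.errorThreshold p μ (Metric.diam Z) Δ ε) →
        T = ⌈C₁ * AIPE.rate p γ μ⌉₊ →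
        S = AIPE.numEpochs Δ ε →
        (T : ℝ) ≤ C₂ * max 1 (AIPE.rate p γ μ) ∧
        (T : ℝ) * S ≤ C₂ * (max 1 (AIPE.rate p γ μ) * max 1 (Real.logb 2 (Δ / ε))) ∧
        ∀ zs : ℕ → EuclideanSpace ℝ (Fin d),
          AIPE.IsRun p γ Z iFunc iGrad iProx T S z0 zs →
            zs S ∈ Z ∧ h (zs S) - h zstar ≤ ε := by
  obtain ⟨C₁, hC₁, C₂, hC₂, hgeneral⟩ := mainTheorem4_general.{0} p hp
  refine ⟨C₁, hC₁, C₂, hC₂, fun d Z h grad iFunc iGrad iProx z0 zstar μ γ δ ε Δ T S hμ hγ hε hZ hc _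
    hh hfunc hgrad hprox hz0 hstar hmin hΔ hthreshold ↦ ?_⟩
  exact hgeneral _ Z h grad iFunc iGrad iProx z0 zstar μ γ δ ε Δ T S hμ hγ hε hZ.isComplete
    hZ.isBounded hc hh hfunc hgrad hprox hz0 hstar hmin hΔ fun hlt ↦
      AIPE.mul_max_le_of_le_errorThreshold hε hlt ((abs_nonneg _).trans (hfunc z0 hz0))
        (hthreshold (hε.trans hlt))
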